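/- Let $\Lambda$ be an artin algebra, that is, an algebra over a commutative artinian ring $R$ which is finitely generated as an $R$-module. Modules are finitely generated left modules, and $\mathrm{mod}\,\Lambda$ is the category of these. Let $\mathfrak{A}$ be a strong idempotent ideal of $\Lambda$: a two-sided ideal with $\mathfrak{A}^2=\mathfrak{A}$ such that the map $\mathrm{Ext}^i_{\Lambda/\mathfrak{A}}(X,Y)\to\mathrm{Ext}^i_{\Lambda}(X,Y)$ induced by the inclusion $\mathrm{mod}\,\Lambda/\mathfrak{A}\subseteq\mathrm{mod}\,\Lambda$ is an isomorphism for all $i\ge 0$ and all $X,Y\in\mathrm{mod}\,\Lambda/\mathfrak{A}$. Let $P$ be a finitely generated projective $\Lambda$-module whose trace in $\Lambda$ (the sum of the images of all homomorphisms $P\to\Lambda$) is $\mathfrak{A}$, let $\Gamma=\mathrm{End}_\Lambda(P)^{op}$, and assume that the global dimension of $\Gamma$ is finite. Then $\phi_r\mathrm{dim}(\Lambda/\mathfrak{A})$ is finite if and only if $\phi_r\mathrm{dim}(\Lambda)$ is finite. Here, for an artin algebra $A$, let $K_0(A)$ be the abelian group generated by the symbols $[M]$, $M\in\mathrm{mod}\,A$,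 modulo the relations $[C]=[B]+[B']$ if $C\simeq B\oplus B'$ and $[I]=0$ if $I$ is injective. Let $\Omega^{-1}:K_0(A)\to K_0(A)$ be the homomorphism with $\Omega^{-1}[M]=[\Omega^{-1}M]$, where $\Omega^{-1}M$ is the cokernel of an embedding of $M$ in its injective envelope (any finitely generated injective module containing $M$ gives the same class). Write $\langle\mathrm{add}\,M\rangle$ for the subgroup of $K_0(A)$ generated by the classes of the indecomposable direct summands of $M$, and $\Omega^{-s}\langle\mathrm{add}\,M\rangle$ for its image under the $s$-th iterate of $\Omega^{-1}$. Then $\phi_r(M)$ is the smallest integer $n\ge 0$ such that $\Omega^{-1}:\Omega^{-s}\langle\mathrm{add}\,M\rangle\to\Omega^{-(s+1)}\langle\mathrm{add}\,M\rangle$ is an isomorphism for all $s\ge n$, and $\phi_r\mathrm{dim}(A)=\sup\{\phi_r(M): M\in\mathrm{mod}\,A\}$. -/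

import Mathlib

open CategoryTheory

universe v u

noncomputable section

namespace IgusaTodorov

/-- The trace `τ_M N` of `M` in `N`: the submodule of `N` generated by the images of all
homomorphisms `M → N`. -/
def traceSubmodule (Λ : Type u) [Ring Λ] (M N : Type*) [AddCommGroup M] [Module Λ M]
    [AddCommGroup N] [Module Λ N] : Submodule Λ N :=
  ⨆ f : M →ₗ[Λ] N, LinearMap.range f

/-- The (left) global dimension of `Γ`: the supremum of the projective dimensions of the finitely
generated left `Γ`-modules. (It is `⊥` for the zero ring and `⊤` if the supremum is infinite.) -/
def globalDim (Γ : Type u) [Ring Γ] : WithBot ℕ∞ :=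
  ⨆ M : FGModuleCat.{u} Γ, projectiveDimension M.obj

/-- Restriction of scalars along a ring homomorphism is an exact functor. -/
instance restrictScalars_preservesHomology {A B : Type u} [Ring A] [Ring B] (f : A →+* B) :
    (ModuleCat.restrictScalars.{u} f).PreservesHomology :=
  Functor.preservesHomology_of_map_exact _ fun S hS ↦ by
    rw [ShortComplex.ShortExact.moduleCat_exact_iff_function_exact] at hS ⊢
    exact hS

instance restrictScalars_preservesFiniteLimits {A B : Type u} [Ring A] [Ring B] (f : A →+* B) :
    Limits.PreservesFiniteLimits (ModuleCat.restrictScalars.{u} f) :=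
  Functor.preservesFiniteLimits_of_preservesHomology _

instance restrictScalars_preservesFiniteColimits {A B : Type u} [Ring A] [Ring B] (f : A →+* B) :
    Limits.PreservesFiniteColimits (ModuleCat.restrictScalars.{u} f) :=
  Functor.preservesFiniteColimits_of_preservesHomology _

/-- A two-sided ideal `𝔄` is a strong idempotent ideal if it is idempotent and, for all finitely
generated `Λ ⧸ 𝔄`-modules `X`, `Y` and all `i ≥ 0`, the map `Ext^i_{Λ/𝔄}(X, Y) → Ext^i_Λ(X, Y)`
induced by the (exact) inclusion of `Λ ⧸ 𝔄`-modules into `Λ`-modules is an isomorphism. -/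
structure IsStrongIdempotent {Λ : Type u} [Ring Λ] (𝔄 : Ideal Λ) [𝔄.IsTwoSided] : Prop where
  idempotent : 𝔄 * 𝔄 = 𝔄
  ext_bijective : ∀ (X Y : FGModuleCat.{u} (Λ ⧸ 𝔄)) (i : ℕ),
    Function.Bijective
      ((ModuleCat.restrictScalars.{u} (Ideal.Quotient.mk 𝔄)).mapExtAddHom X.obj Y.obj i)

section

variable (Λ : Type u) [Ring Λ]

/-- The defining relations of `K₀`, in its form for injectives:
`[C] = [A] + [B]` if `C ≃ A ⊕ B`, and `[I] = 0` if `I` is injective. -/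
def K₀Relations : Set (FreeAbelianGroup (FGModuleCat.{u} Λ)) :=
  {x | ∃ A B C : FGModuleCat.{u} Λ, Nonempty (C ≃ₗ[Λ] A × B) ∧
      x = FreeAbelianGroup.of C - (FreeAbelianGroup.of A + FreeAbelianGroup.of B)} ∪
  {x | ∃ I : FGModuleCat.{u} Λ, Module.Injective Λ I ∧ x = FreeAbelianGroup.of I}

/-- The abelian group generated by symbols `[M]`, for `M` a finitely generated `Λ`-module, modulo
`[C] = [A] + [B]` if `C ≃ A ⊕ B` and `[I] = 0` if `I` is injective. -/
abbrev K₀ : Type (u + 1) :=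
  FreeAbelianGroup (FGModuleCat.{u} Λ) ⧸ AddSubgroup.closure (K₀Relations Λ)

variable {Λ} in
/-- The class `[M]` of a finitely generated module `M` in `K₀`. -/
def K₀.mk (M : FGModuleCat.{u} Λ) : K₀ Λ :=
  QuotientAddGroup.mk (FreeAbelianGroup.of M)

variable {Λ} in
/-- `f` sends `[M]` to `[Ω⁻¹ M]`, for every finitely generated `M`. Here `Ω⁻¹ M` is computed as
`I ⧸ M` for embeddings of `M` in a finitely generated injective module `I`; different choices of
`I` (such as the injective envelope) change `I ⧸ M` only up to injective direct summands, and thus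
give the same class in `K₀`. -/
def IsCosyzygyMap (f : K₀ Λ →+ K₀ Λ) : Prop :=
  ∀ (M I : FGModuleCat.{u} Λ) (j : M →ₗ[Λ] I), Module.Injective Λ I → Function.Injective j →
    f (K₀.mk M) = K₀.mk (FGModuleCat.of Λ (I ⧸ LinearMap.range j))

/-- The endomorphism of `K₀` induced by the cosyzygy, `[M] ↦ [Ω⁻¹ M]`. For an artin algebra `Λ`
there is exactly one homomorphism satisfying `IsCosyzygyMap`, since finitely generated modules
have finitely generated injective envelopes. -/
def cosyzygyMap : K₀ Λ →+ K₀ Λ :=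
  Classical.epsilon IsCosyzygyMap

variable {Λ}

/-- The subgroup `⟨add M⟩` of `K₀` generated by the classes of the indecomposable direct summands
of `M`. -/
def addSpan (M : FGModuleCat.{u} Λ) : AddSubgroup (K₀ Λ) :=
  AddSubgroup.closure {x | ∃ N N' : FGModuleCat.{u} Λ,
    Indecomposable N.obj ∧ Nonempty (M ≃ₗ[Λ] N × N') ∧ x = K₀.mk N}

/-- The image `Ω⁻ˢ⟨add M⟩` of `⟨add M⟩` under the `s`-th iterate of the cosyzygy map. -/
def cosyzygySpan (M : FGModuleCat.{u} Λ) : ℕ → AddSubgroup (K₀ Λ)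
  | 0 => addSpan M
  | s + 1 => (cosyzygySpan M s).map (cosyzygyMap Λ)

/-- The Igusa-Todorov function `φ_r`: the smallest `n` such that the cosyzygy map induces an
isomorphism `Ω⁻ˢ⟨add M⟩ → Ω⁻⁽ˢ⁺¹⁾⟨add M⟩` for all `s ≥ n` (and `⊤` if there were no such `n`). -/
def phiR (M : FGModuleCat.{u} Λ) : ℕ∞ :=
  ⨅ (n : ℕ) (_ : ∀ s, n ≤ s →
    Set.BijOn (cosyzygyMap Λ) (cosyzygySpan M s) (cosyzygySpan M (s + 1))), (n : ℕ∞)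

variable (Λ) in
/-- The `φ_r`-dimension of `Λ`: the supremum of `φ_r M` over the finitely generated left
`Λ`-modules `M`. -/
def phiRDim : ℕ∞ :=
  ⨆ M : FGModuleCat.{u} Λ, phiR M

end

end IgusaTodorov

end

noncomputable section

namespace IgusaTodorov

/-- `ExtVanish Λ X Y i` says that `Ext^i_Λ(X, Y) = 0`. -/
def ExtVanish (Λ : Type u) [Ring Λ] (X Y : Type u) [AddCommGroup X] [Module Λ X]
    [AddCommGroup Y] [Module Λ Y] (i : ℕ) : Prop :=
  ∀ e : Abelian.Ext (ModuleCat.of Λ X) (ModuleCat.of Λ Y) i, e = 0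

namespace ExtVanish

variable {Λ : Type u} [Ring Λ] {A B C X Y : Type u}
  [AddCommGroup A] [Module Λ A] [AddCommGroup B] [Module Λ B] [AddCommGroup C] [Module Λ C]
  [AddCommGroup X] [Module Λ X] [AddCommGroup Y] [Module Λ Y] {i : ℕ}

theorem zero_iff : ExtVanish Λ X Y 0 ↔ ∀ f : X →ₗ[Λ] Y, f = 0 := by
  constructor
  · intro h f
    have h1 := h (Abelian.Ext.mk₀ (ModuleCat.ofHom f))
    rw [← Abelian.Ext.mk₀_zero] at h1
    have h2 := (Abelian.Ext.mk₀_bijective _ _).1 h1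
    simpa using congrArg ModuleCat.Hom.hom h2
  · intro h e
    obtain ⟨f, rfl⟩ := (Abelian.Ext.mk₀_bijective _ _).2 e
    have : f = 0 := ModuleCat.hom_ext (h f.hom)
    rw [this, Abelian.Ext.mk₀_zero]

theorem of_retract_left (i' : X →ₗ[Λ] A) (r : A →ₗ[Λ] X) (hr : r ∘ₗ i' = LinearMap.id)
    (h : ExtVanish Λ A Y i) : ExtVanish Λ X Y i := by
  intro e
  have h1 := h ((Abelian.Ext.mk₀ (ModuleCat.ofHom r)).comp e (zero_add i))
  have h2 := congrArg (fun z ↦ (Abelian.Ext.mk₀ (ModuleCat.ofHom i')).comp z (zero_add i)) h1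
  simp only [Abelian.Ext.mk₀_comp_mk₀_assoc, Abelian.Ext.comp_zero] at h2
  rwa [← ModuleCat.ofHom_comp, hr, ModuleCat.ofHom_id, Abelian.Ext.mk₀_id_comp] at h2

theorem of_retract_right (i' : Y →ₗ[Λ] A) (r : A →ₗ[Λ] Y) (hr : r ∘ₗ i' = LinearMap.id)
    (h : ExtVanish Λ X A i) : ExtVanish Λ X Y i := by
  intro e
  have h1 := h (e.comp (Abelian.Ext.mk₀ (ModuleCat.ofHom i')) (add_zero i))
  have h2 := congrArg (fun z ↦ z.comp (Abelian.Ext.mk₀ (ModuleCat.ofHom r)) (add_zero i)) h1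
  simp only [Abelian.Ext.comp_assoc_of_second_deg_zero, Abelian.Ext.zero_comp,
    Abelian.Ext.mk₀_comp_mk₀] at h2
  rwa [← ModuleCat.ofHom_comp, hr, ModuleCat.ofHom_id, Abelian.Ext.comp_mk₀_id] at h2

theorem of_equiv_left (e : X ≃ₗ[Λ] A) (h : ExtVanish Λ A Y i) : ExtVanish Λ X Y i :=
  h.of_retract_left e.toLinearMap e.symm.toLinearMap (by ext; simp)

theorem of_projective [Module.Projective Λ X] : ExtVanish Λ X Y (i + 1) := fun e ↦
  haveI : Projective (ModuleCat.of Λ X) := (IsProjective.iff_projective X).1 inferInstance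
  Abelian.Ext.eq_zero_of_projective e

theorem of_injective (hY : Module.Injective Λ Y) : ExtVanish Λ X Y (i + 1) := fun e ↦
  haveI : Injective (ModuleCat.of Λ Y) := (Module.injective_iff_injective_object Λ Y).1 hY
  Abelian.Ext.eq_zero_of_injective e

end ExtVanish

section

variable {Λ : Type u} [Ring Λ] {A B C X Y : Type u}
  [AddCommGroup A] [Module Λ A] [AddCommGroup B] [Module Λ B] [AddCommGroup C] [Module Λ C]
  [AddCommGroup X] [Module Λ X] [AddCommGroup Y] [Module Λ Y] {i : ℕ}

/-- `f` and `g` form a short exact sequence `0 → A → B → C → 0` of modules. -/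
structure IsSES (f : A →ₗ[Λ] B) (g : B →ₗ[Λ] C) : Prop where
  inj : Function.Injective f
  exact : Function.Exact f g
  surj : Function.Surjective g

namespace IsSES

theorem of_submodule (N : Submodule Λ B) : IsSES N.subtype N.mkQ :=
  ⟨N.subtype_injective, LinearMap.exact_subtype_mkQ N, N.mkQ_surjective⟩

theorem of_ker (g : B →ₗ[Λ] C) (hg : Function.Surjective g) :
    IsSES (LinearMap.ker g).subtype g :=
  ⟨Subtype.val_injective, LinearMap.exact_subtype_ker_map g, hg⟩

theorem of_range (f : A →ₗ[Λ] B) (hf : Function.Injective f) :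
    IsSES f (LinearMap.range f).mkQ :=
  ⟨hf, LinearMap.exact_map_mkQ_range f, Submodule.mkQ_surjective _⟩

theorem prod : IsSES (LinearMap.inl Λ A B) (LinearMap.snd Λ A B) :=
  ⟨LinearMap.inl_injective, Function.Exact.inl_snd, LinearMap.snd_surjective⟩

variable {f : A →ₗ[Λ] B} {g : B →ₗ[Λ] C} (h : IsSES f g)

include h

/-- The short exact sequence in the category of modules. -/
theorem shortExact : (ShortComplex.mk (ModuleCat.ofHom f) (ModuleCat.ofHom g)
      (by ext x; exact h.exact.apply_apply_eq_zero x)).ShortExact where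
  exact := (ShortComplex.ShortExact.moduleCat_exact_iff_function_exact _).2 h.exact
  mono_f := (ModuleCat.mono_iff_injective _).2 h.inj
  epi_g := (ModuleCat.epi_iff_surjective _).2 h.surj

theorem left_middle (hA : ExtVanish Λ A Y i) (hC : ExtVanish Λ C Y i) : ExtVanish Λ B Y i := by
  intro e
  obtain ⟨x, hx⟩ := Abelian.Ext.contravariant_sequence_exact₂ h.shortExact _ e (hA _)
  rw [← hx, hC x, Abelian.Ext.comp_zero]

theorem left_fst (hB : ExtVanish Λ B Y i) (hC : ExtVanish Λ C Y (i + 1)) :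
    ExtVanish Λ A Y i := by
  intro e
  obtain ⟨x, hx⟩ := Abelian.Ext.contravariant_sequence_exact₁ h.shortExact _ e (add_comm 1 i) (hC _)
  rw [← hx, hB x, Abelian.Ext.comp_zero]

theorem left_last (hA : ExtVanish Λ A Y i) (hB : ExtVanish Λ B Y (i + 1)) :
    ExtVanish Λ C Y (i + 1) := by
  intro e
  obtain ⟨x, hx⟩ := Abelian.Ext.contravariant_sequence_exact₃ h.shortExact _ e (hB _) (add_comm 1 i)
  rw [← hx, hA x, Abelian.Ext.comp_zero]

theorem right_fst (hB : ExtVanish Λ X B (i + 1)) (hC : ExtVanish Λ X C i) :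
    ExtVanish Λ X A (i + 1) := by
  intro e
  obtain ⟨x, hx⟩ := Abelian.Ext.covariant_sequence_exact₁ _ h.shortExact e (hB _) rfl
  rw [← hx, hC x, Abelian.Ext.zero_comp]

theorem right_last (hA : ExtVanish Λ X A (i + 1)) (hB : ExtVanish Λ X B i) :
    ExtVanish Λ X C i := by
  intro e
  obtain ⟨x, hx⟩ := Abelian.Ext.covariant_sequence_exact₃ _ h.shortExact e rfl (hA _)
  rw [← hx, hB x, Abelian.Ext.zero_comp]

theorem exists_lift (hA : ExtVanish Λ X A 1) (φ : X →ₗ[Λ] C) : ∃ ψ : X →ₗ[Λ] B, g ∘ₗ ψ = φ := by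
  obtain ⟨x, hx⟩ := Abelian.Ext.covariant_sequence_exact₃ _ h.shortExact
    (Abelian.Ext.mk₀ (ModuleCat.ofHom φ)) (zero_add 1) (hA _)
  obtain ⟨ψ, rfl⟩ := (Abelian.Ext.mk₀_bijective _ _).2 x
  rw [Abelian.Ext.mk₀_comp_mk₀] at hx
  exact ⟨ψ.hom, congrArg ModuleCat.Hom.hom ((Abelian.Ext.mk₀_bijective _ _).1 hx)⟩

theorem exists_extend (hC : ExtVanish Λ C Y 1) (φ : A →ₗ[Λ] Y) :
    ∃ ψ : B →ₗ[Λ] Y, ψ ∘ₗ f = φ := by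
  obtain ⟨x, hx⟩ := Abelian.Ext.contravariant_sequence_exact₁ h.shortExact _
    (Abelian.Ext.mk₀ (ModuleCat.ofHom φ)) (add_zero 1) (hC _)
  obtain ⟨ψ, rfl⟩ := (Abelian.Ext.mk₀_bijective _ _).2 x
  rw [Abelian.Ext.mk₀_comp_mk₀] at hx
  exact ⟨ψ.hom, congrArg ModuleCat.Hom.hom ((Abelian.Ext.mk₀_bijective _ _).1 hx)⟩

end IsSES

theorem ExtVanish.prod_left (hA : ExtVanish Λ A Y i) (hB : ExtVanish Λ B Y i) :
    ExtVanish Λ (A × B) Y i :=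
  IsSES.prod.left_middle hA hB

theorem ExtVanish.pi_left (hA : ExtVanish Λ A Y i) (n : ℕ) : ExtVanish Λ (Fin n → A) Y i := by
  induction n with
  | zero =>
    exact ExtVanish.of_retract_left (A := A) 0 0 (LinearMap.ext fun x ↦ Subsingleton.elim _ _) hA
  | succ n ih => exact (hA.prod_left ih).of_equiv_left (Fin.consLinearEquiv Λ fun _ ↦ A).symm

/-- A module `Y` with `Ext¹(X, Y) = 0` for all finitely generated `X` is injective. -/
theorem injective_of_extVanish
    (h : ∀ (X : Type u) [AddCommGroup X] [Module Λ X] [Module.Finite Λ X], ExtVanish Λ X Y 1) :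
    Module.Injective Λ Y := by
  apply Module.Baer.injective
  intro I f
  obtain ⟨ψ, hψ⟩ := (IsSES.of_submodule (Λ := Λ) (B := Λ) I).exists_extend (h _) f
  exact ⟨ψ, fun x hx ↦ by rw [← hψ]; rfl⟩

end

section

variable {Λ : Type u} [Ring Λ]

section Injective

variable {M N : Type u} [AddCommGroup M] [Module Λ M] [AddCommGroup N] [Module Λ N]

theorem injective_of_retract (i : M →ₗ[Λ] N) (r : N →ₗ[Λ] M) (hr : r ∘ₗ i = LinearMap.id)
    (hN : Module.Injective Λ N) : Module.Injective Λ M where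
  out X Y _ _ _ _ f hf g := by
    obtain ⟨h, hh⟩ := hN.out f hf (i ∘ₗ g)
    exact ⟨r ∘ₗ h, fun x ↦ by simpa [hh] using LinearMap.congr_fun hr (g x)⟩

theorem injective_of_equiv (e : M ≃ₗ[Λ] N) (hN : Module.Injective Λ N) : Module.Injective Λ M :=
  injective_of_retract e.toLinearMap e.symm.toLinearMap (by ext; simp) hN

theorem injective_prod (hM : Module.Injective Λ M) (hN : Module.Injective Λ N) :
    Module.Injective Λ (M × N) where
  out X Y _ _ _ _ f hf g := by
    obtain ⟨h, hh⟩ := hM.out f hf (LinearMap.fst Λ M N ∘ₗ g)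
    obtain ⟨h', hh'⟩ := hN.out f hf (LinearMap.snd Λ M N ∘ₗ g)
    exact ⟨h.prod h', fun x ↦ Prod.ext (hh x) (hh' x)⟩

theorem injective_of_prod_left (h : Module.Injective Λ (M × N)) : Module.Injective Λ M :=
  injective_of_retract (LinearMap.inl Λ M N) (LinearMap.fst Λ M N) (by ext; simp) h

theorem injective_of_subsingleton [Subsingleton M] : Module.Injective Λ M where
  out _ _ _ _ _ _ _ _ _ := ⟨0, fun _ ↦ Subsingleton.elim _ _⟩

end Injective

variable (Λ) in
/-- `M` and `N` become isomorphic after adding finitely generated injective modules. -/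
def StablyIso (M N : Type u) [AddCommGroup M] [Module Λ M] [AddCommGroup N] [Module Λ N] : Prop :=
  ∃ I J : FGModuleCat.{u} Λ, Module.Injective Λ I ∧ Module.Injective Λ J ∧
    Nonempty ((M × I) ≃ₗ[Λ] (N × J))

namespace StablyIso

variable {M N L : Type u} [AddCommGroup M] [Module Λ M] [AddCommGroup N] [Module Λ N]
  [AddCommGroup L] [Module Λ L]

theorem of_prod_equiv {I J : Type u} [AddCommGroup I] [Module Λ I] [AddCommGroup J] [Module Λ J]
    [Module.Finite Λ I] [Module.Finite Λ J]
    (hI : Module.Injective Λ I) (hJ : Module.Injective Λ J) (e : (M × I) ≃ₗ[Λ] (N × J)) :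
    StablyIso Λ M N :=
  ⟨.of Λ I, .of Λ J, hI, hJ, ⟨e⟩⟩

theorem of_equiv (e : M ≃ₗ[Λ] N) : StablyIso Λ M N :=
  of_prod_equiv (I := PUnit) (J := PUnit) injective_of_subsingleton injective_of_subsingleton
    (e.prodCongr (.refl _ _))

theorem refl (M : Type u) [AddCommGroup M] [Module Λ M] : StablyIso Λ M M := of_equiv (.refl _ _)

theorem symm (h : StablyIso Λ M N) : StablyIso Λ N M := by
  obtain ⟨I, J, hI, hJ, ⟨e⟩⟩ := h
  exact ⟨J, I, hJ, hI, ⟨e.symm⟩⟩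

/-- Interchange of the last two factors. -/
def prodRightComm (A B C : Type u) [AddCommGroup A] [Module Λ A] [AddCommGroup B] [Module Λ B]
    [AddCommGroup C] [Module Λ C] : ((A × B) × C) ≃ₗ[Λ] ((A × C) × B) :=
  (LinearEquiv.prodAssoc Λ A B C).trans
    (((LinearEquiv.refl Λ A).prodCongr (LinearEquiv.prodComm Λ B C)).trans
      (LinearEquiv.prodAssoc Λ A C B).symm)

theorem trans (h : StablyIso Λ M N) (h' : StablyIso Λ N L) : StablyIso Λ M L := by
  obtain ⟨I, J, hI, hJ, ⟨e⟩⟩ := h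
  obtain ⟨I', J', hI', hJ', ⟨e'⟩⟩ := h'
  refine of_prod_equiv (I := I × I') (J := J' × J) (injective_prod hI hI')
    (injective_prod hJ' hJ) ?_
  exact (LinearEquiv.prodAssoc Λ M I I').symm.trans <| (e.prodCongr (.refl _ _)).trans <|
    (prodRightComm N J I').trans <| (e'.prodCongr (.refl _ _)).trans <|
    LinearEquiv.prodAssoc Λ L J' J

theorem injective (h : StablyIso Λ M N) (hN : Module.Injective Λ N) : Module.Injective Λ M := by
  obtain ⟨I, J, hI, hJ, ⟨e⟩⟩ := h
  exact injective_of_prod_left (injective_of_equiv e (injective_prod hN hJ))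

theorem prod_injective [Module.Finite Λ N] (hN : Module.Injective Λ N) :
    StablyIso Λ (M × N) M :=
  of_prod_equiv (I := PUnit) injective_of_subsingleton hN LinearEquiv.prodUnique

end StablyIso

/-- Two surjections with the same kernel have isomorphic targets. -/
theorem nonempty_equiv_of_ker_eq {M N L : Type u} [AddCommGroup M] [Module Λ M] [AddCommGroup N]
    [Module Λ N] [AddCommGroup L] [Module Λ L] {f : M →ₗ[Λ] N} {g : M →ₗ[Λ] L}
    (hf : Function.Surjective f) (hg : Function.Surjective g)
    (h : LinearMap.ker f = LinearMap.ker g) : Nonempty (N ≃ₗ[Λ] L) :=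
  ⟨(f.quotKerEquivOfSurjective hf).symm.trans <| (Submodule.quotEquivOfEq _ _ h).trans <|
    g.quotKerEquivOfSurjective hg⟩

/-- Schanuel's lemma for injective modules. -/
theorem IsSES.schanuel {M I I' C C' : Type u} [AddCommGroup M] [Module Λ M]
    [AddCommGroup I] [Module Λ I] [AddCommGroup I'] [Module Λ I'] [AddCommGroup C] [Module Λ C]
    [AddCommGroup C'] [Module Λ C'] [Module.Finite Λ I] [Module.Finite Λ I']
    {j : M →ₗ[Λ] I} {p : I →ₗ[Λ] C} {j' : M →ₗ[Λ] I'} {p' : I' →ₗ[Λ] C'}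
    (h : IsSES j p) (h' : IsSES j' p') (hI : Module.Injective Λ I) (hI' : Module.Injective Λ I') :
    StablyIso Λ C C' := by
  obtain ⟨a, ha⟩ := hI'.out j h.inj j'
  obtain ⟨b, hb⟩ := hI.out j' h'.inj j
  let φ : (I × I') →ₗ[Λ] (C × I') :=
    (p ∘ₗ LinearMap.fst Λ I I').prod (LinearMap.snd Λ I I' - a ∘ₗ LinearMap.fst Λ I I')
  let ψ : (I × I') →ₗ[Λ] (C' × I) :=
    (p' ∘ₗ LinearMap.snd Λ I I').prod (LinearMap.fst Λ I I' - b ∘ₗ LinearMap.snd Λ I I')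
  have hφ : Function.Surjective φ := by
    rintro ⟨c, y⟩
    obtain ⟨x, rfl⟩ := h.surj c
    exact ⟨(x, y + a x), by simp [φ]⟩
  have hψ : Function.Surjective ψ := by
    rintro ⟨c, x⟩
    obtain ⟨y, rfl⟩ := h'.surj c
    exact ⟨(x + b y, y), by simp [ψ]⟩
  have hφk : ∀ z : I × I', z ∈ LinearMap.ker φ ↔ ∃ m, z = (j m, j' m) := by
    rintro ⟨x, y⟩
    simp only [φ, LinearMap.mem_ker, LinearMap.prod_apply, Function.prod, LinearMap.comp_apply,
      LinearMap.fst_apply, LinearMap.snd_apply, LinearMap.sub_apply, Prod.mk_eq_zero,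
      Prod.mk.injEq, sub_eq_zero]
    constructor
    · rintro ⟨hx, hy⟩
      obtain ⟨m, rfl⟩ := (h.exact x).1 hx
      exact ⟨m, rfl, by rw [hy, ha]⟩
    · rintro ⟨m, rfl, rfl⟩
      exact ⟨h.exact.apply_apply_eq_zero m, (ha m).symm⟩
  have hψk : ∀ z : I × I', z ∈ LinearMap.ker ψ ↔ ∃ m, z = (j m, j' m) := by
    rintro ⟨x, y⟩
    simp only [ψ, LinearMap.mem_ker, LinearMap.prod_apply, Function.prod, LinearMap.comp_apply,
      LinearMap.fst_apply, LinearMap.snd_apply, LinearMap.sub_apply, Prod.mk_eq_zero,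
      Prod.mk.injEq, sub_eq_zero]
    constructor
    · rintro ⟨hx, hy⟩
      obtain ⟨m, rfl⟩ := (h'.exact y).1 hx
      exact ⟨m, by rw [hy, hb], rfl⟩
    · rintro ⟨m, rfl, rfl⟩
      exact ⟨h'.exact.apply_apply_eq_zero m, (hb m).symm⟩
  obtain ⟨e⟩ := nonempty_equiv_of_ker_eq hφ hψ (by ext z; rw [hφk, hψk])
  exact StablyIso.of_prod_equiv hI' hI e

namespace IsSES

variable {A B C A' B' C' : Type u} [AddCommGroup A] [Module Λ A] [AddCommGroup B] [Module Λ B]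
  [AddCommGroup C] [Module Λ C] [AddCommGroup A'] [Module Λ A'] [AddCommGroup B'] [Module Λ B']
  [AddCommGroup C'] [Module Λ C'] {f : A →ₗ[Λ] B} {g : B →ₗ[Λ] C} {f' : A' →ₗ[Λ] B'}
  {g' : B' →ₗ[Λ] C'}

theorem prodMap (h : IsSES f g) (h' : IsSES f' g') : IsSES (f.prodMap f') (g.prodMap g') where
  inj := by
    rw [LinearMap.coe_prodMap]
    exact h.inj.prodMap h'.inj
  exact := by
    rintro ⟨x, y⟩
    simp only [LinearMap.prodMap_apply, Prod.mk_eq_zero, h.exact x, h'.exact y, Set.mem_range,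
      Prod.exists, Prod.mk.injEq]
    constructor
    · rintro ⟨⟨a, rfl⟩, b, rfl⟩
      exact ⟨a, b, rfl, rfl⟩
    · rintro ⟨a, b, rfl, rfl⟩
      exact ⟨⟨a, rfl⟩, b, rfl⟩
  surj := by
    rw [LinearMap.coe_prodMap]
    exact h.surj.prodMap h'.surj

theorem comp_equiv (h : IsSES f g) (e : A' ≃ₗ[Λ] A) : IsSES (f ∘ₗ e.toLinearMap) g where
  inj := h.inj.comp e.injective
  exact := fun x ↦ (h.exact x).trans ⟨fun ⟨a, ha⟩ ↦ ⟨e.symm a, by simpa⟩, fun ⟨a, ha⟩ ↦ ⟨e a, ha⟩⟩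
  surj := h.surj

theorem id_zero : IsSES (LinearMap.id : A →ₗ[Λ] A) (0 : A →ₗ[Λ] PUnit.{u + 1}) :=
  ⟨fun _ _ h ↦ h, fun x ↦ by simp, fun _ ↦ ⟨0, rfl⟩⟩

end IsSES

variable (Λ) in
/-- Every finitely generated module embeds in a finitely generated injective module. -/
def EnoughFGInjectives : Prop :=
  ∀ M : FGModuleCat.{u} Λ, ∃ (I : FGModuleCat.{u} Λ) (j : M →ₗ[Λ] I),
    Module.Injective Λ I ∧ Function.Injective j

section Cosyzygy

variable (H : EnoughFGInjectives Λ)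

/-- A finitely generated injective module containing `M`. -/
def injHull (M : FGModuleCat.{u} Λ) : FGModuleCat.{u} Λ := (H M).choose

/-- The embedding of `M` in `injHull H M`. -/
def injHullι (M : FGModuleCat.{u} Λ) : M →ₗ[Λ] injHull H M := (H M).choose_spec.choose

theorem injHull_injective (M : FGModuleCat.{u} Λ) : Module.Injective Λ (injHull H M) :=
  (H M).choose_spec.choose_spec.1

theorem injHullι_injective (M : FGModuleCat.{u} Λ) : Function.Injective (injHullι H M) :=
  (H M).choose_spec.choose_spec.2

/-- A cosyzygy of `M`. -/
def cos (M : FGModuleCat.{u} Λ) : FGModuleCat.{u} Λ :=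
  FGModuleCat.of Λ (injHull H M ⧸ LinearMap.range (injHullι H M))

/-- The projection of `injHull H M` onto the cosyzygy. -/
def cosπ (M : FGModuleCat.{u} Λ) : injHull H M →ₗ[Λ] cos H M :=
  (LinearMap.range (injHullι H M)).mkQ

theorem cos_ses (M : FGModuleCat.{u} Λ) : IsSES (injHullι H M) (cosπ H M) :=
  IsSES.of_range _ (injHullι_injective H M)

theorem IsSES.stablyIso_cos {M I C : FGModuleCat.{u} Λ} {j : M →ₗ[Λ] I} {p : I →ₗ[Λ] C}
    (h : IsSES j p) (hI : Module.Injective Λ I) : StablyIso Λ C (cos H M) :=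
  h.schanuel (cos_ses H M) hI (injHull_injective H M)

variable {M N : FGModuleCat.{u} Λ}

theorem StablyIso.cos (h : StablyIso Λ M N) : StablyIso Λ (cos H M) (cos H N) := by
  obtain ⟨I, J, hI, hJ, ⟨e⟩⟩ := h
  have h1 := ((cos_ses H M).prodMap (IsSES.id_zero (Λ := Λ) (A := I)))
  have h2 := ((cos_ses H N).prodMap (IsSES.id_zero (Λ := Λ) (A := J))).comp_equiv e
  have h3 := h1.schanuel h2 (injective_prod (injHull_injective H M) hI)
    (injective_prod (injHull_injective H N) hJ)
  exact ((of_equiv LinearEquiv.prodUnique.symm).trans h3).trans (of_equiv LinearEquiv.prodUnique)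

theorem cos_prod (C : FGModuleCat.{u} Λ) (h : StablyIso Λ C (M × N)) :
    StablyIso Λ (cos H C) (cos H M × cos H N) := by
  have h1 : StablyIso Λ (cos H C) (cos H (.of Λ (M × N))) := StablyIso.cos (N := .of Λ (M × N)) H h
  exact h1.trans <| (cos_ses H (.of Λ (M × N))).schanuel ((cos_ses H M).prodMap (cos_ses H N))
    (injHull_injective H _) (injective_prod (injHull_injective H M) (injHull_injective H N))

theorem cos_injective (hM : Module.Injective Λ M) : Module.Injective Λ (cos H M) := by
  have h : IsSES (LinearMap.id : M →ₗ[Λ] M) (0 : M →ₗ[Λ] (FGModuleCat.of Λ PUnit.{u + 1})) :=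
    IsSES.id_zero
  exact (h.stablyIso_cos H hM).symm.injective injective_of_subsingleton

/-- The iterated cosyzygy. -/
abbrev cosIter (k : ℕ) (M : FGModuleCat.{u} Λ) : FGModuleCat.{u} Λ := (cos H)^[k] M

theorem cosIter_succ (k : ℕ) (M : FGModuleCat.{u} Λ) :
    cosIter H (k + 1) M = cos H (cosIter H k M) :=
  Function.iterate_succ_apply' _ _ _

theorem cosIter_prod (C : FGModuleCat.{u} Λ) (h : StablyIso Λ C (M × N)) (k : ℕ) :
    StablyIso Λ (cosIter H k C) (cosIter H k M × cosIter H k N) := by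
  induction k with
  | zero => exact h
  | succ k ih =>
    rw [cosIter_succ, cosIter_succ, cosIter_succ]
    exact cos_prod H _ ih

theorem cosIter_injective (hM : Module.Injective Λ M) (k : ℕ) :
    Module.Injective Λ (cosIter H k M) := by
  induction k with
  | zero => exact hM
  | succ k ih =>
    rw [cosIter_succ]
    exact cos_injective H ih

theorem cosIter_injective_mono {k l : ℕ} (hkl : k ≤ l)
    (hM : Module.Injective Λ (cosIter H k M)) : Module.Injective Λ (cosIter H l M) := by
  obtain ⟨m, rfl⟩ := Nat.exists_eq_add_of_le' hkl
  have : IgusaTodorov.cosIter H (m + k) M = IgusaTodorov.cosIter H m (IgusaTodorov.cosIter H k M) :=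
    Function.iterate_add_apply _ _ _ _
  rw [this]
  exact cosIter_injective H hM m

/-- Rotation of a short exact sequence `0 → A → B → C → 0` to
`0 → C → Ω⁻¹ A → Ω⁻¹ B → 0`. -/
theorem IsSES.rotate {A B C : FGModuleCat.{u} Λ} {f : A →ₗ[Λ] B} {g : B →ₗ[Λ] C} (h : IsSES f g) :
    ∃ (A' : FGModuleCat.{u} Λ) (f' : C →ₗ[Λ] A') (g' : A' →ₗ[Λ] IgusaTodorov.cos H B),
      IsSES f' g' ∧ StablyIso Λ A' (IgusaTodorov.cos H A) := by
  let j := injHullι H B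
  let A' := FGModuleCat.of Λ (injHull H B ⧸ LinearMap.range (j ∘ₗ f))
  have hj := cos_ses H B
  have hker : LinearMap.ker g ≤ LinearMap.ker ((LinearMap.range (j ∘ₗ f)).mkQ ∘ₗ j) := by
    intro x hx
    obtain ⟨a, rfl⟩ := (h.exact x).1 hx
    simp only [LinearMap.mem_ker, LinearMap.comp_apply, Submodule.mkQ_apply,
      Submodule.Quotient.mk_eq_zero]
    exact ⟨a, rfl⟩
  let f' : C →ₗ[Λ] A' := (LinearMap.ker g).liftQ _ hker ∘ₗ
    (g.quotKerEquivOfSurjective h.surj).symm.toLinearMap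
  have hf' : ∀ b, f' (g b) = (LinearMap.range (j ∘ₗ f)).mkQ (j b) := by
    intro b
    have : (g.quotKerEquivOfSurjective h.surj).symm (g b) = (LinearMap.ker g).mkQ b := by
      rw [LinearEquiv.symm_apply_eq]; rfl
    simp only [f', LinearMap.comp_apply, LinearEquiv.coe_coe, this]
    rfl
  have hr : LinearMap.range (j ∘ₗ f) ≤ LinearMap.ker (cosπ H B) := by
    rintro _ ⟨a, rfl⟩
    exact hj.exact.apply_apply_eq_zero (f a)
  let g' : A' →ₗ[Λ] IgusaTodorov.cos H B := (LinearMap.range (j ∘ₗ f)).liftQ (cosπ H B) hr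
  refine ⟨A', f', g', ⟨?_, ?_, ?_⟩, ?_⟩
  · rw [injective_iff_map_eq_zero]
    intro c hc
    obtain ⟨b, rfl⟩ := h.surj c
    rw [hf', Submodule.mkQ_apply, Submodule.Quotient.mk_eq_zero] at hc
    obtain ⟨a, ha⟩ := hc
    rw [← hj.inj ha]
    exact h.exact.apply_apply_eq_zero a
  · intro x
    obtain ⟨y, rfl⟩ := (LinearMap.range (j ∘ₗ f)).mkQ_surjective x
    constructor
    · intro hy
      obtain ⟨b, rfl⟩ := (hj.exact y).1 hy
      exact ⟨g b, hf' b⟩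
    · rintro ⟨c, hc⟩
      obtain ⟨b, rfl⟩ := h.surj c
      rw [← hc, hf']
      exact hj.exact.apply_apply_eq_zero b
  · intro c
    obtain ⟨y, rfl⟩ := hj.surj c
    exact ⟨(LinearMap.range (j ∘ₗ f)).mkQ y, rfl⟩
  · exact IsSES.stablyIso_cos (M := A) (C := A') H (IsSES.of_range (j ∘ₗ f) (hj.inj.comp h.inj))
      (injHull_injective H B)

variable (Λ) in
/-- There is a short exact sequence `0 → A' → B' → C' → 0` of finitely generated modules that are
stably isomorphic to `A`, `B`, `C`. -/
def StableSES (A B C : FGModuleCat.{u} Λ) : Prop :=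
  ∃ (A' B' C' : FGModuleCat.{u} Λ) (f : A' →ₗ[Λ] B') (g : B' →ₗ[Λ] C'),
    IsSES f g ∧ StablyIso Λ A' A ∧ StablyIso Λ B' B ∧ StablyIso Λ C' C

theorem IsSES.stableSES {A B C : FGModuleCat.{u} Λ} {f : A →ₗ[Λ] B} {g : B →ₗ[Λ] C}
    (h : IsSES f g) : StableSES Λ A B C :=
  ⟨A, B, C, f, g, h, .refl _, .refl _, .refl _⟩

namespace StableSES

variable {A B C : FGModuleCat.{u} Λ}

theorem rotate (h : StableSES Λ A B C) :
    StableSES Λ C (IgusaTodorov.cos H A) (IgusaTodorov.cos H B) := by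
  obtain ⟨A', B', C', f, g, h, hA, hB, hC⟩ := h
  obtain ⟨A'', f', g', h', hA'⟩ := h.rotate H
  exact ⟨C', A'', _, f', g', h', hC, hA'.trans (hA.cos H), hB.cos H⟩

theorem cosIter (h : StableSES Λ A B C) (k : ℕ) :
    StableSES Λ (cosIter H (2 * k) A) (cosIter H (2 * k) B) (cosIter H (2 * k) C) := by
  induction k with
  | zero => exact h
  | succ k ih =>
    rw [show 2 * (k + 1) = 2 * k + 1 + 1 from rfl]
    simp only [cosIter_succ] at ih ⊢
    exact ((ih.rotate H).rotate H).rotate H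

theorem of_middle_injective (h : StableSES Λ A B C) (hB : Module.Injective Λ B) :
    StablyIso Λ C (IgusaTodorov.cos H A) := by
  obtain ⟨A', B', C', f, g, h, hA, hB', hC⟩ := h
  exact hC.symm.trans <| (h.stablyIso_cos H (hB'.injective hB)).trans <| hA.cos H

theorem of_last_injective (h : StableSES Λ A B C) (hC : Module.Injective Λ C) :
    StablyIso Λ (IgusaTodorov.cos H A) (IgusaTodorov.cos H B) := by
  obtain ⟨A', B', C', f, g, h, hA, hB, hC'⟩ := h.rotate H
  have hA' := hA.injective hC
  obtain ⟨r, hr⟩ := hA'.out f h.inj LinearMap.id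
  have hs : LinearMap.ker (g.prod r) = LinearMap.ker (LinearMap.id : B' →ₗ[Λ] B') := by
    rw [LinearMap.ker_id, Submodule.eq_bot_iff]
    intro x hx
    simp only [LinearMap.mem_ker, LinearMap.prod_apply, Function.prod, Prod.mk_eq_zero] at hx
    obtain ⟨a, rfl⟩ := (h.exact x).1 hx.1
    have := hr a
    rw [hx.2] at this
    rw [show a = 0 from this.symm, map_zero]
  obtain ⟨e⟩ := nonempty_equiv_of_ker_eq (f := g.prod r) (g := (LinearMap.id : B' →ₗ[Λ] B'))
    (by
      rintro ⟨c, a⟩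
      obtain ⟨b, rfl⟩ := h.surj c
      have h1 : ∀ x, g (f x) = 0 := h.exact.apply_apply_eq_zero
      refine ⟨b + f (a - r b), ?_⟩
      simp only [LinearMap.prod_apply, Function.prod, map_add, h1, hr]
      simp) Function.surjective_id hs
  exact hB.symm.trans <| (StablyIso.of_equiv e.symm).trans <|
    (StablyIso.prod_injective hA').trans hC'

end StableSES

end Cosyzygy

end

namespace K₀

variable {Λ : Type u} [Ring Λ]

theorem mk_eq_add {A B C : FGModuleCat.{u} Λ} (e : C ≃ₗ[Λ] A × B) :
    K₀.mk C = K₀.mk A + K₀.mk B := by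
  rw [← sub_eq_zero]
  exact (QuotientAddGroup.eq_zero_iff _).2 (AddSubgroup.subset_closure (Or.inl ⟨A, B, C, ⟨e⟩, rfl⟩))

theorem mk_injective {I : FGModuleCat.{u} Λ} (hI : Module.Injective Λ I) : K₀.mk I = 0 :=
  (QuotientAddGroup.eq_zero_iff _).2 (AddSubgroup.subset_closure (Or.inr ⟨I, hI, rfl⟩))

theorem mk_eq_of_stablyIso {A B : FGModuleCat.{u} Λ} (h : StablyIso Λ A B) :
    K₀.mk A = K₀.mk B := by
  obtain ⟨I, J, hI, hJ, ⟨e⟩⟩ := h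
  have h1 := mk_eq_add (C := .of Λ (A × I)) (LinearEquiv.refl Λ (A × I))
  have h2 := mk_eq_add (C := .of Λ (A × I)) e
  rw [mk_injective hI, add_zero] at h1
  rw [mk_injective hJ, add_zero] at h2
  rw [← h1, h2]

theorem mk_eq_add_of_stablyIso {A B C : FGModuleCat.{u} Λ} (h : StablyIso Λ C (A × B)) :
    K₀.mk C = K₀.mk A + K₀.mk B := by
  rw [mk_eq_of_stablyIso (B := .of Λ (A × B)) h]
  exact mk_eq_add (.refl Λ _)

/-- A homomorphism out of `K₀`, from an additive function vanishing on injective modules. -/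
def lift {G : Type*} [AddCommGroup G] (h : FGModuleCat.{u} Λ → G)
    (hadd : ∀ A B C : FGModuleCat.{u} Λ, (C ≃ₗ[Λ] A × B) → h C = h A + h B)
    (hinj : ∀ I : FGModuleCat.{u} Λ, Module.Injective Λ I → h I = 0) : K₀ Λ →+ G :=
  QuotientAddGroup.lift _ (FreeAbelianGroup.lift h) <| by
    rw [AddSubgroup.closure_le]
    rintro _ (⟨A, B, C, ⟨e⟩, rfl⟩ | ⟨I, hI, rfl⟩)
    · simp [hadd A B C e]
    · simp [hinj I hI]

theorem lift_mk {G : Type*} [AddCommGroup G] (h : FGModuleCat.{u} Λ → G)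
    (hadd : ∀ A B C : FGModuleCat.{u} Λ, (C ≃ₗ[Λ] A × B) → h C = h A + h B)
    (hinj : ∀ I : FGModuleCat.{u} Λ, Module.Injective Λ I → h I = 0) (M : FGModuleCat.{u} Λ) :
    lift h hadd hinj (K₀.mk M) = h M :=
  FreeAbelianGroup.lift_apply_of _ _

theorem exists_eq_sub (x : K₀ Λ) : ∃ A B : FGModuleCat.{u} Λ, x = K₀.mk A - K₀.mk B := by
  induction x using QuotientAddGroup.induction_on with
  | H z =>
    have h0 : K₀.mk (FGModuleCat.of Λ PUnit.{u + 1}) = 0 := mk_injective injective_of_subsingleton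
    induction z using FreeAbelianGroup.induction_on with
    | zero => exact ⟨.of Λ PUnit, .of Λ PUnit, (sub_self _).symm⟩
    | of M => exact ⟨M, .of Λ PUnit, by rw [h0, sub_zero]; rfl⟩
    | neg M => exact ⟨.of Λ PUnit, M, by rw [h0, zero_sub]; rfl⟩
    | add x y hx hy =>
      obtain ⟨A, B, hx⟩ := hx
      obtain ⟨A', B', hy⟩ := hy
      refine ⟨.of Λ (A × A'), .of Λ (B × B'), ?_⟩
      rw [mk_eq_add (C := .of Λ (A × A')) (.refl Λ _), mk_eq_add (C := .of Λ (B × B')) (.refl Λ _),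
        QuotientAddGroup.mk_add, hx, hy]
      abel

theorem hom_eq {G : Type*} [AddCommGroup G] {f g : K₀ Λ →+ G}
    (h : ∀ M : FGModuleCat.{u} Λ, f (K₀.mk M) = g (K₀.mk M)) (x : K₀ Λ) : f x = g x := by
  obtain ⟨A, B, rfl⟩ := exists_eq_sub x
  rw [map_sub, map_sub, h, h]

end K₀

section

variable {Λ : Type u} [Ring Λ] (H : EnoughFGInjectives Λ)

include H

theorem isCosyzygyMap_cosyzygyMap : IsCosyzygyMap (cosyzygyMap Λ) := by
  refine Classical.epsilon_spec (p := IsCosyzygyMap (Λ := Λ)) ⟨K₀.lift (fun M ↦ K₀.mk (cos H M))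
    (fun A B C e ↦ ?_) (fun I hI ↦ ?_), fun M I j hI hj ↦ ?_⟩
  · exact K₀.mk_eq_add_of_stablyIso (cos_prod H C (.of_equiv e))
  · exact K₀.mk_injective (cos_injective H hI)
  · rw [K₀.lift_mk]
    exact (K₀.mk_eq_of_stablyIso (IsSES.stablyIso_cos (C := .of Λ (I ⧸ LinearMap.range j)) H
      (IsSES.of_range j hj) hI)).symm

theorem cosyzygyMap_mk (M : FGModuleCat.{u} Λ) : cosyzygyMap Λ (K₀.mk M) = K₀.mk (cos H M) :=
  isCosyzygyMap_cosyzygyMap H M _ _ (injHull_injective H M) (injHullι_injective H M)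

theorem cosyzygyMap_iterate_mk (k : ℕ) (M : FGModuleCat.{u} Λ) :
    (cosyzygyMap Λ)^[k] (K₀.mk M) = K₀.mk (cosIter H k M) := by
  induction k with
  | zero => rfl
  | succ k ih => rw [Function.iterate_succ_apply', ih, cosyzygyMap_mk H, cosIter_succ]

end

section Decomposition

variable {Λ : Type u} [Ring Λ]

theorem addSpan_mono {M N N' : FGModuleCat.{u} Λ} (e : M ≃ₗ[Λ] N × N') :
    addSpan N ≤ addSpan M := by
  refine AddSubgroup.closure_mono ?_
  rintro x ⟨L, L', hL, ⟨e'⟩, rfl⟩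
  exact ⟨L, .of Λ (L' × N'), hL, ⟨e.trans <| (e'.prodCongr (.refl Λ N')).trans
    (LinearEquiv.prodAssoc Λ L L' N')⟩, rfl⟩

theorem mk_mem_addSpan [IsArtinianRing Λ] (M : FGModuleCat.{u} Λ) : K₀.mk M ∈ addSpan M := by
  induction h : Module.length Λ M using WellFoundedLT.induction generalizing M with
  | ind n ih =>
    by_cases hM : Subsingleton M
    · rw [K₀.mk_injective injective_of_subsingleton]
      exact zero_mem _
    by_cases hi : Indecomposable M.obj
    · refine AddSubgroup.subset_closure ⟨M, .of Λ PUnit, hi, ⟨LinearEquiv.prodUnique.symm⟩, rfl⟩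
    · have hz : ¬ Limits.IsZero M.obj := fun hz ↦ hM (ModuleCat.isZero_iff_subsingleton.1 hz)
      simp only [Indecomposable, hz, not_false_eq_true, true_and, not_forall, not_or] at hi
      obtain ⟨Y, Z, e, hY, hZ⟩ := hi
      rw [ModuleCat.isZero_iff_subsingleton, not_subsingleton_iff_nontrivial] at hY hZ
      let e' : M ≃ₗ[Λ] Y × Z := (e ≪≫ ModuleCat.biprodIsoProd Y Z).toLinearEquiv
      have : Module.Finite Λ (Y × Z) := Module.Finite.equiv e'
      have : Module.Finite Λ Y :=
        Module.Finite.of_surjective (LinearMap.fst Λ Y Z) LinearMap.fst_surjective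
      have : Module.Finite Λ Z :=
        Module.Finite.of_surjective (LinearMap.snd Λ Y Z) LinearMap.snd_surjective
      have hl := e'.length_eq.trans (Module.length_prod Λ Y Z)
      have hYt : Module.length Λ Y ≠ ⊤ := Module.length_ne_top
      have hZt : Module.length Λ Z ≠ ⊤ := Module.length_ne_top
      have hYp : Module.length Λ Y ≠ 0 := Module.length_pos.ne'
      have hZp : Module.length Λ Z ≠ 0 := Module.length_pos.ne'
      have hlt : ∀ {a b : ℕ∞}, a ≠ ⊤ → b ≠ 0 → a < a + b := fun {a b} ha hb ↦ by
        simpa using (ENat.add_lt_add_iff_left ha).2 (pos_of_ne_zero hb)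
      have h1 : Module.length Λ Y < n := by
        rw [← h, hl]
        exact hlt hYt hZp
      have h2 : Module.length Λ Z < n := by
        rw [← h, hl, add_comm]
        exact hlt hZt hYp
      rw [K₀.mk_eq_add (A := .of Λ Y) (B := .of Λ Z) e']
      exact add_mem (addSpan_mono (N := .of Λ Y) (N' := .of Λ Z) e' (ih _ h1 (.of Λ Y) rfl))
        (addSpan_mono (N := .of Λ Z) (N' := .of Λ Y) (e'.trans (LinearEquiv.prodComm Λ Y Z))
          (ih _ h2 (.of Λ Z) rfl))

theorem exists_mem_addSpan [IsArtinianRing Λ] (x : K₀ Λ) :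
    ∃ M : FGModuleCat.{u} Λ, x ∈ addSpan M := by
  obtain ⟨A, B, rfl⟩ := K₀.exists_eq_sub x
  exact ⟨.of Λ (A × B), sub_mem
    (addSpan_mono (M := .of Λ (A × B)) (.refl Λ (A × B)) (mk_mem_addSpan A))
    (addSpan_mono (M := .of Λ (A × B)) (LinearEquiv.prodComm Λ A B) (mk_mem_addSpan B))⟩

theorem mem_cosyzygySpan {M : FGModuleCat.{u} Λ} {s : ℕ} {x : K₀ Λ} :
    x ∈ cosyzygySpan M s ↔ ∃ y ∈ addSpan M, (cosyzygyMap Λ)^[s] y = x := by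
  induction s generalizing x with
  | zero => simp [cosyzygySpan]
  | succ s ih =>
    simp only [cosyzygySpan, AddSubgroup.mem_map, ih, Function.iterate_succ_apply']
    constructor
    · rintro ⟨_, ⟨y, hy, rfl⟩, rfl⟩
      exact ⟨y, hy, rfl⟩
    · rintro ⟨y, hy, rfl⟩
      exact ⟨_, ⟨y, hy, rfl⟩, rfl⟩

/-- The `φ_r`-dimension is finite if and only if the kernels of the iterates of the cosyzygy map
become stationary. -/
theorem phiRDim_lt_top_iff [IsArtinianRing Λ] :
    phiRDim Λ < ⊤ ↔ ∃ n : ℕ, ∀ s, n ≤ s → ∀ x : K₀ Λ,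
      (cosyzygyMap Λ)^[s + 1] x = 0 → (cosyzygyMap Λ)^[s] x = 0 := by
  have h0 : ∀ s : ℕ, (cosyzygyMap Λ)^[s] 0 = 0 := iterate_map_zero (cosyzygyMap Λ)
  constructor
  · intro h
    obtain ⟨n, hn⟩ := ENat.ne_top_iff_exists.1 h.ne
    refine ⟨n, fun s hs x hx ↦ ?_⟩
    obtain ⟨M, hM⟩ := exists_mem_addSpan x
    have h1 : phiR M < (n + 1 : ℕ) := by
      refine lt_of_le_of_lt (le_iSup phiR M) ?_
      change phiRDim Λ < _
      rw [← hn]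
      exact_mod_cast Nat.lt_succ_self n
    simp only [phiR, iInf_lt_iff] at h1
    obtain ⟨m, hm, hmn⟩ := h1
    have hmn' : m ≤ s := by
      have : m < n + 1 := by exact_mod_cast hmn
      omega
    refine (hm s hmn').injOn (mem_cosyzygySpan.2 ⟨x, hM, rfl⟩) (zero_mem _) ?_
    rw [← Function.iterate_succ_apply' (cosyzygyMap Λ), hx, map_zero]
  · rintro ⟨n, hn⟩
    refine lt_of_le_of_lt (iSup_le fun M ↦ ?_) (ENat.natCast_lt_top n)
    refine iInf₂_le n fun s hs ↦ ⟨?_, ?_, ?_⟩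
    · intro x hx
      exact AddSubgroup.mem_map_of_mem _ hx
    · intro x hx y hy hxy
      have hd := (cosyzygySpan M s).sub_mem hx hy
      obtain ⟨z, -, hz⟩ := mem_cosyzygySpan.1 hd
      have h1 : (cosyzygyMap Λ)^[s + 1] z = 0 := by
        rw [Function.iterate_succ_apply', hz, map_sub, hxy, sub_self]
      rw [← sub_eq_zero, ← hz, hn s hs z h1]
    · rintro x ⟨y, hy, rfl⟩
      exact ⟨y, hy, rfl⟩

/-- Transfer of the finiteness of the `φ_r`-dimension along a pair of homomorphisms that commute
with the cosyzygy maps and compose to one of their iterates. -/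
theorem phiRDim_lt_top_of_intertwine {Λ' : Type u} [Ring Λ'] [IsArtinianRing Λ]
    [IsArtinianRing Λ'] (F : K₀ Λ →+ K₀ Λ') (G : K₀ Λ' →+ K₀ Λ) (m : ℕ)
    (hF : ∀ x, F (cosyzygyMap Λ x) = cosyzygyMap Λ' (F x))
    (hG : ∀ x, G (cosyzygyMap Λ' x) = cosyzygyMap Λ (G x))
    (hGF : ∀ x, G (F x) = (cosyzygyMap Λ)^[m] x)
    (h : phiRDim Λ' < ⊤) : phiRDim Λ < ⊤ := by
  rw [phiRDim_lt_top_iff] at h ⊢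
  obtain ⟨n, hn⟩ := h
  refine ⟨n + m, fun s hs x hx ↦ ?_⟩
  obtain ⟨t, rfl⟩ := Nat.exists_eq_add_of_le' hs
  have hF' : ∀ k x, F ((cosyzygyMap Λ)^[k] x) = (cosyzygyMap Λ')^[k] (F x) := fun k x ↦
    Function.Semiconj.iterate_right hF k x
  have hG' : ∀ k x, G ((cosyzygyMap Λ')^[k] x) = (cosyzygyMap Λ)^[k] (G x) := fun k x ↦
    Function.Semiconj.iterate_right hG k x
  have key : ∀ r, n ≤ r → ∀ y, (cosyzygyMap Λ')^[r + m + 1] y = 0 →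
      (cosyzygyMap Λ')^[r] y = 0 := by
    intro r hr y hy
    have : ∀ j, (cosyzygyMap Λ')^[r + j] y = 0 → (cosyzygyMap Λ')^[r] y = 0 := by
      intro j
      induction j with
      | zero => exact id
      | succ j ih => exact fun hj ↦ ih (hn (r + j) (by omega) y hj)
    exact this (m + 1) hy
  have h1 : (cosyzygyMap Λ')^[t + n] (F x) = 0 := by
    apply key _ (by omega)
    rw [← hF', show t + n + m + 1 = t + (n + m) + 1 by omega, hx, map_zero]
  rw [show t + (n + m) = t + n + m by omega, Function.iterate_add_apply, ← hGF, ← hG', h1, map_zero]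

end Decomposition

/-- Every module embeds in an injective module as an essential submodule. -/
theorem exists_injective_essential {R : Type u} [Ring R] (S : Type u) [AddCommGroup S]
    [Module R S] : ∃ (E : ModuleCat.{u} R) (j : S →ₗ[R] E), Module.Injective R E ∧
      Function.Injective j ∧ ∀ x : E, x ≠ 0 → ∃ a : R, a • x ≠ 0 ∧ a • x ∈ LinearMap.range j := by
  obtain ⟨⟨I, hI, j, hj⟩⟩ := EnoughInjectives.presentation (ModuleCat.of R S)
  have hI' : Module.Injective R I := (Module.injective_iff_injective_object R I).2 hI
  have hj' : Function.Injective j.hom := (ModuleCat.mono_iff_injective j).1 hj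
  let P : Set (Submodule R I) := {E | LinearMap.range j.hom ≤ E ∧
    ∀ x ∈ E, x ≠ 0 → ∃ a : R, a • x ≠ 0 ∧ a • x ∈ LinearMap.range j.hom}
  obtain ⟨E, hSE, hE⟩ : ∃ E, LinearMap.range j.hom ≤ E ∧ Maximal (· ∈ P) E := by
    refine zorn_le_nonempty₀ P (fun c hc hch y hy ↦ ?_) _ ⟨le_rfl, fun x hx h0 ↦ ?_⟩
    · refine ⟨sSup c, ⟨(hc hy).1.trans (le_sSup hy), fun x hx h0 ↦ ?_⟩, fun z hz ↦ le_sSup hz⟩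
      obtain ⟨z, hz, hxz⟩ := (Submodule.mem_sSup_of_directed ⟨y, hy⟩ hch.directedOn).1 hx
      exact (hc hz).2 x hxz h0
    · exact ⟨1, by rwa [one_smul], by rwa [one_smul]⟩
  obtain ⟨C, -, hC⟩ : ∃ C, ⊥ ≤ C ∧ Maximal (· ∈ {C : Submodule R I | C ⊓ E = ⊥}) C := by
    refine zorn_le_nonempty₀ _ (fun c hc hch y hy ↦ ?_) _ (bot_inf_eq E)
    refine ⟨sSup c, ?_, fun z hz ↦ le_sSup hz⟩
    rw [Set.mem_ofPred_eq, Submodule.eq_bot_iff]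
    rintro x ⟨hx, hxE⟩
    obtain ⟨z, hz, hxz⟩ := (Submodule.mem_sSup_of_directed ⟨y, hy⟩ hch.directedOn).1 hx
    have : x ∈ z ⊓ E := ⟨hxz, hxE⟩
    rwa [show z ⊓ E = ⊥ from hc hz, Submodule.mem_bot] at this
  have hCE : C ⊓ E = ⊥ := hC.prop
  obtain ⟨h, hh⟩ := hI'.out (C.mkQ ∘ₗ E.subtype) (by
    rw [injective_iff_map_eq_zero]
    intro x hx
    have : (x : I) ∈ C ⊓ E := ⟨by simpa using hx, x.2⟩
    rw [hCE, Submodule.mem_bot] at this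
    exact Subtype.ext this) E.subtype
  let q : I →ₗ[R] I := h ∘ₗ C.mkQ
  have hq : ∀ x ∈ E, q x = x := fun x hx ↦ hh ⟨x, hx⟩
  have hrange : LinearMap.range q ∈ P := by
    refine ⟨fun x hx ↦ ⟨x, hq x (hSE hx)⟩, ?_⟩
    rintro _ ⟨x, rfl⟩ h0
    have hxC : x ∉ C := by
      intro hx
      apply h0
      simp [q, (Submodule.Quotient.mk_eq_zero C).2 hx]
    have hne : (C ⊔ Submodule.span R {x}) ⊓ E ≠ ⊥ := by
      intro hbot
      exact hxC (hC.le_of_ge hbot le_sup_left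
        (Submodule.mem_sup_right (Submodule.mem_span_singleton_self x)))
    obtain ⟨e, ⟨he, heE⟩, he0⟩ := Submodule.exists_mem_ne_zero_of_ne_bot hne
    obtain ⟨c, hc, y, hy, rfl⟩ := Submodule.mem_sup.1 he
    obtain ⟨a, rfl⟩ := Submodule.mem_span_singleton.1 hy
    have h1 : a • q x = c + a • x := by
      rw [← hq _ heE, map_add, map_smul]
      simp [q, (Submodule.Quotient.mk_eq_zero C).2 hc]
    obtain ⟨b, hb0, hb⟩ := hE.prop.2 _ heE he0
    refine ⟨b * a, ?_⟩
    rw [mul_smul, h1]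
    exact ⟨hb0, hb⟩
  have hrE : LinearMap.range q ≤ E := hE.le_of_ge hrange fun x hx ↦ ⟨x, hq x hx⟩
  refine ⟨ModuleCat.of R E, j.hom.codRestrict E fun x ↦ hSE ⟨x, rfl⟩, ?_, ?_, ?_⟩
  · exact injective_of_retract E.subtype (q.codRestrict E fun x ↦ hrE ⟨x, rfl⟩)
      (LinearMap.ext fun x ↦ Subtype.ext (hq x x.2)) hI'
  · exact fun x y hxy ↦ hj' (congrArg Subtype.val hxy)
  · rintro ⟨x, hx⟩ h0
    obtain ⟨a, ha0, s, hs⟩ := hE.prop.2 x hx (fun h ↦ h0 (Subtype.ext h))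
    exact ⟨a, fun h ↦ ha0 (congrArg Subtype.val h), s, Subtype.ext hs⟩

/-- Over a commutative artinian ring, there is an injective cogenerator `E` such that `Hom(M, E)`
is finitely generated for all finitely generated `M`. -/
theorem exists_injective_cogenerator (R : Type u) [CommRing R] [IsArtinianRing R] :
    ∃ E : ModuleCat.{u} R, Module.Injective R E ∧
      (∀ (M : Type u) [AddCommGroup M] [Module R M] (x : M), x ≠ 0 →
        ∃ f : M →ₗ[R] E, f x ≠ 0) ∧
      ∀ (M : Type u) [AddCommGroup M] [Module R M] [Module.Finite R M],
        IsNoetherian R (M →ₗ[R] E) := by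
  classical
  let S := ∀ m : MaximalSpectrum R, R ⧸ m.asIdeal
  obtain ⟨E, j, hE, hj, hess⟩ := exists_injective_essential (R := R) S
  refine ⟨E, hE, ?_, ?_⟩
  · intro M _ _ x hx
    let t : R →ₗ[R] M := LinearMap.toSpanSingleton R M x
    have ht : LinearMap.ker t ≠ ⊤ := by
      intro h
      have : (1 : R) ∈ LinearMap.ker t := h ▸ Submodule.mem_top
      simp [t, hx] at this
    obtain ⟨m, hm, hle⟩ := Ideal.exists_le_maximal (LinearMap.ker t) ht
    let s : (R ⧸ m) →ₗ[R] S :=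
      LinearMap.single R (fun m : MaximalSpectrum R ↦ R ⧸ m.asIdeal) ⟨m, hm⟩
    let φ : (R ⧸ LinearMap.ker t) →ₗ[R] E := j ∘ₗ s ∘ₗ Submodule.factor hle
    obtain ⟨f, hf⟩ := hE.out ((LinearMap.ker t).liftQ t le_rfl)
      (LinearMap.ker_eq_bot.1 (Submodule.ker_liftQ_eq_bot _ _ _ le_rfl)) φ
    refine ⟨f, ?_⟩
    have h1 : f x = φ ((LinearMap.ker t).mkQ 1) := by
      rw [← hf, Submodule.mkQ_apply, Submodule.liftQ_apply, LinearMap.toSpanSingleton_apply_one]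
    rw [h1]
    intro h0
    have h2 : s ((Submodule.factor hle) ((LinearMap.ker t).mkQ 1)) = 0 :=
      hj (h0.trans (map_zero j).symm)
    have h3 := congrFun h2 ⟨m, hm⟩
    have h5 : ∀ z, s z ⟨m, hm⟩ = z := fun z ↦
      Pi.single_eq_same (M := fun m : MaximalSpectrum R ↦ R ⧸ m.asIdeal) ⟨m, hm⟩ z
    rw [h5] at h3
    have h4 : (1 : R) ∈ m := by
      rw [← Submodule.Quotient.mk_eq_zero]
      exact h3
    exact hm.ne_top ((Ideal.eq_top_iff_one m).2 h4)
  · intro M _ _ hM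
    induction hM using IsNoetherianRing.induction_on_isQuotientEquivQuotientPrime R with
    | subsingleton N =>
      have : Subsingleton (N →ₗ[R] E) :=
        ⟨fun f g ↦ LinearMap.ext fun x ↦ by rw [Subsingleton.elim x 0, map_zero, map_zero]⟩
      infer_instance
    | quotient N p e =>
      have hp : p.1.IsMaximal := inferInstance
      have hr : ∀ f : N →ₗ[R] E, f (e.symm (Submodule.Quotient.mk 1)) ∈ LinearMap.range j := by
        intro f
        by_cases h0 : f (e.symm (Submodule.Quotient.mk 1)) = 0
        · rw [h0]
          exact zero_mem _
        obtain ⟨a, ha0, ha⟩ := hess _ h0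
        have hmul : ∀ c : R, c • f (e.symm (Submodule.Quotient.mk 1)) =
            f (e.symm (Submodule.Quotient.mk c)) := by
          intro c
          rw [← map_smul, ← map_smul, ← Submodule.Quotient.mk_smul, smul_eq_mul, mul_one]
        have hap : a ∉ p.1 := by
          intro h
          apply ha0
          rw [hmul, (Submodule.Quotient.mk_eq_zero _).2 h, map_zero, map_zero]
        obtain ⟨b, i, hi, hb⟩ := hp.exists_inv hap
        have h1 : (b * a) • f (e.symm (Submodule.Quotient.mk 1)) =
            f (e.symm (Submodule.Quotient.mk 1)) := by
          rw [hmul, ← hb, Submodule.Quotient.mk_add, (Submodule.Quotient.mk_eq_zero _).2 hi,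
            add_zero]
        rw [← h1, mul_smul]
        exact Submodule.smul_mem _ _ ha
      let ev : (N →ₗ[R] E) →ₗ[R] LinearMap.range j :=
        (LinearMap.applyₗ (e.symm (Submodule.Quotient.mk 1))).codRestrict _ hr
      refine isNoetherian_of_injective ev ?_
      rw [injective_iff_map_eq_zero]
      intro f hf
      ext x
      obtain ⟨y, rfl⟩ := e.symm.surjective x
      obtain ⟨c, rfl⟩ := Submodule.Quotient.mk_surjective _ y
      have h1 : f (e.symm (Submodule.Quotient.mk 1)) = 0 := congrArg Subtype.val hf
      have h2 : (Submodule.Quotient.mk c : R ⧸ p.1) = c • Submodule.Quotient.mk 1 := by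
        rw [← Submodule.Quotient.mk_smul, smul_eq_mul, mul_one]
      rw [h2, map_smul, map_smul, h1, smul_zero, LinearMap.zero_apply]
    | exact N₁ N₂ N₃ f g hf hg hfg h₁ h₃ =>
      refine isNoetherian_of_range_eq_ker (LinearMap.lcomp R E g) (LinearMap.lcomp R E f) ?_
      ext φ
      simp only [LinearMap.mem_range, LinearMap.mem_ker]
      constructor
      · rintro ⟨ψ, rfl⟩
        ext x
        simp [hfg.apply_apply_eq_zero]
      · intro hφ
        have hk : LinearMap.ker g ≤ LinearMap.ker φ := by
          intro x hx
          obtain ⟨a, rfl⟩ := (hfg x).1 hx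
          exact LinearMap.congr_fun hφ a
        refine ⟨(LinearMap.ker g).liftQ φ hk ∘ₗ
          (g.quotKerEquivOfSurjective hg).symm.toLinearMap, ?_⟩
        ext x
        have : (g.quotKerEquivOfSurjective hg).symm (g x) = (LinearMap.ker g).mkQ x := by
          rw [LinearEquiv.symm_apply_eq]; rfl
        simp [this]

section Coinduced

variable (R : Type u) [CommRing R] (Λ : Type u) [Ring Λ] [Algebra R Λ] (E : Type u)
  [AddCommGroup E] [Module R E]

/-- The coinduced `Λ`-module `Hom_R(Λ, E)`. -/
def Coinduced : Type u := Λ →ₗ[R] E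

instance : AddCommGroup (Coinduced R Λ E) := inferInstanceAs (AddCommGroup (Λ →ₗ[R] E))

instance : FunLike (Coinduced R Λ E) Λ E := inferInstanceAs (FunLike (Λ →ₗ[R] E) Λ E)

instance : LinearMapClass (Coinduced R Λ E) R Λ E :=
  inferInstanceAs (LinearMapClass (Λ →ₗ[R] E) R Λ E)

instance : SMul Λ (Coinduced R Λ E) where
  smul a f := LinearMap.comp (f : Λ →ₗ[R] E) (LinearMap.mulRight R a)

variable {R Λ E}

namespace Coinduced

@[ext]
theorem ext {f g : Coinduced R Λ E} (h : ∀ a, f a = g a) : f = g := DFunLike.ext f g h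

theorem smul_apply (a : Λ) (f : Coinduced R Λ E) (x : Λ) : (a • f) x = f (x * a) := rfl

theorem add_apply (f g : Coinduced R Λ E) (x : Λ) : (f + g) x = f x + g x := rfl

theorem zero_apply (x : Λ) : (0 : Coinduced R Λ E) x = 0 := rfl

instance : Module Λ (Coinduced R Λ E) where
  one_smul f := ext fun x ↦ by rw [smul_apply, mul_one]
  mul_smul a b f := ext fun x ↦ by simp only [smul_apply, mul_assoc]
  smul_zero _ := rfl
  smul_add _ _ _ := rfl
  add_smul a b f := ext fun x ↦ by simp only [smul_apply, add_apply, mul_add, map_add]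
  zero_smul f := ext fun x ↦ by simp only [smul_apply, zero_apply, mul_zero, map_zero]

/-- The `Λ`-linear map `M → Hom_R(Λ, E)` that corresponds to an `R`-linear map `M → E`. -/
def lift {M : Type u} [AddCommGroup M] [Module Λ M] [Module R M] [IsScalarTower R Λ M]
    (f : M →ₗ[R] E) : M →ₗ[Λ] Coinduced R Λ E where
  toFun m := f ∘ₗ ((LinearMap.toSpanSingleton Λ M m).restrictScalars R)
  map_add' x y := ext fun a ↦ (congrArg f (smul_add a x y)).trans (map_add f _ _)
  map_smul' b x := ext fun a ↦ congrArg f (smul_smul a b x)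

theorem lift_apply {M : Type u} [AddCommGroup M] [Module Λ M] [Module R M]
    [IsScalarTower R Λ M] (f : M →ₗ[R] E) (m : M) (a : Λ) : lift f m a = f (a • m) := rfl

theorem injective (hE : Module.Injective R E) : Module.Injective Λ (Coinduced R Λ E) where
  out X Y _ _ _ _ f hf g := by
    let : Module R X := Module.compHom X (algebraMap R Λ)
    let : Module R Y := Module.compHom Y (algebraMap R Λ)
    have : IsScalarTower R Λ X := .of_algebraMap_smul fun _ _ ↦ rfl
    have : IsScalarTower R Λ Y := .of_algebraMap_smul fun _ _ ↦ rfl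
    let g₀ : X →ₗ[R] E :=
      { toFun x := g x 1
        map_add' x y := by rw [map_add]; rfl
        map_smul' r x := by
          have h1 : g (r • x) = algebraMap R Λ r • g x := by
            rw [← map_smul, algebraMap_smul]
          rw [h1, smul_apply, one_mul, Algebra.algebraMap_eq_smul_one, map_smul, RingHom.id_apply] }
    obtain ⟨h, hh⟩ := hE.out (f.restrictScalars R) hf g₀
    refine ⟨lift h, fun x ↦ ext fun a ↦ ?_⟩
    rw [lift_apply, ← map_smul]
    refine (hh (a • x)).trans ?_
    change g (a • x) 1 = _
    rw [map_smul, smul_apply, one_mul]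

theorem finite [Module.Finite R (Λ →ₗ[R] E)] : Module.Finite Λ (Coinduced R Λ E) := by
  obtain ⟨s, hs⟩ := (Module.Finite.fg_top : (⊤ : Submodule R (Λ →ₗ[R] E)).FG)
  let s' : Finset (Coinduced R Λ E) := s
  refine ⟨⟨s', ?_⟩⟩
  rw [eq_top_iff]
  rintro (f : Λ →ₗ[R] E) -
  have hf : f ∈ Submodule.span R (s : Set (Λ →ₗ[R] E)) := hs ▸ Submodule.mem_top
  induction hf using Submodule.span_induction with
  | mem x hx => exact Submodule.subset_span (s := (s' : Set (Coinduced R Λ E))) hx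
  | zero => exact zero_mem (Submodule.span Λ (s' : Set (Coinduced R Λ E)))
  | add x y _ _ hx hy => exact add_mem (S := Submodule Λ (Coinduced R Λ E)) hx hy
  | smul r x _ hx =>
    have : (show Coinduced R Λ E from r • x) =
        algebraMap R Λ r • (show Coinduced R Λ E from x) := by
      refine ext fun a ↦ ?_
      change r • x a = x (a * algebraMap R Λ r)
      rw [← map_smul, Algebra.smul_def, Algebra.commutes]
    change (show Coinduced R Λ E from r • x) ∈ _
    rw [this]
    exact Submodule.smul_mem _ _ hx

end Coinduced

end Coinduced

/-- If elements of finitely generated modules are separated by maps to finitely generated injective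
modules, then there are enough of these. -/
theorem enoughFGInjectives_of_separating {Λ : Type u} [Ring Λ] [IsArtinianRing Λ]
    (h : ∀ (M : FGModuleCat.{u} Λ) (x : M), x ≠ 0 → ∃ (I : FGModuleCat.{u} Λ) (f : M →ₗ[Λ] I),
      Module.Injective Λ I ∧ f x ≠ 0) : EnoughFGInjectives Λ := by
  intro M
  let P : Set (Submodule Λ M) := {K | ∃ (I : FGModuleCat.{u} Λ) (f : M →ₗ[Λ] I),
      Module.Injective Λ I ∧ LinearMap.ker f = K}
  obtain ⟨K, ⟨I, f, hI, rfl⟩, hK⟩ := WellFounded.has_min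
    (wellFounded_lt : WellFounded ((· < ·) : Submodule Λ M → Submodule Λ M → Prop)) P
    ⟨⊤, .of Λ PUnit, 0, injective_of_subsingleton, LinearMap.ker_zero⟩
  refine ⟨I, f, hI, ?_⟩
  rw [injective_iff_map_eq_zero]
  intro x hx
  by_contra h0
  obtain ⟨J, g, hJ, hg⟩ := h M x h0
  refine hK _ ⟨.of Λ (I × J), f.prod g, injective_prod hI hJ, rfl⟩ ?_
  rw [LinearMap.ker_prod]
  refine lt_of_le_of_ne inf_le_left fun he ↦ hg ?_
  have hx' : x ∈ LinearMap.ker f ⊓ LinearMap.ker g := by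
    rw [he]
    exact hx
  exact hx'.2

theorem isArtinianRing_of_artin_algebra (R : Type v) [CommRing R] [IsArtinianRing R] (Λ : Type u)
    [Ring Λ] [Algebra R Λ] [Module.Finite R Λ] : IsArtinianRing Λ :=
  isArtinian_of_tower R inferInstance

/-- An artin algebra has enough finitely generated injective modules. -/
theorem enoughFGInjectives (R : Type v) [CommRing R] [IsArtinianRing R] (Λ : Type u) [Ring Λ]
    [Algebra R Λ] [Module.Finite R Λ] : EnoughFGInjectives Λ := by
  have hΛ := isArtinianRing_of_artin_algebra R Λ
  have : Small.{u} (R ⧸ RingHom.ker (algebraMap R Λ)) :=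
    small_of_injective (RingHom.kerLift_injective (algebraMap R Λ))
  let R' := Shrink.{u} (R ⧸ RingHom.ker (algebraMap R Λ))
  let e : R' ≃+* R ⧸ RingHom.ker (algebraMap R Λ) := Shrink.ringEquiv _
  let π : R →+* R' := e.symm.toRingHom.comp (Ideal.Quotient.mk _)
  have hπ : Function.Surjective π := e.symm.surjective.comp Ideal.Quotient.mk_surjective
  have : IsArtinianRing R' := hπ.isArtinianRing
  let φ : R' →+* Λ := (RingHom.kerLift (algebraMap R Λ)).comp e.toRingHom
  have hφ : ∀ r, φ (π r) = algebraMap R Λ r := by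
    intro r
    simp [φ, π]
  let : Algebra R' Λ := φ.toAlgebra' (fun r x ↦ by
    obtain ⟨r, rfl⟩ := hπ r
    rw [hφ, Algebra.commutes])
  have : Module.Finite R' Λ := by
    obtain ⟨s, hs⟩ := (Module.Finite.fg_top : (⊤ : Submodule R Λ).FG)
    refine ⟨⟨s, ?_⟩⟩
    rw [eq_top_iff]
    rintro x -
    have hx : x ∈ Submodule.span R (s : Set Λ) := hs ▸ Submodule.mem_top
    induction hx using Submodule.span_induction with
    | mem x hx => exact Submodule.subset_span hx
    | zero => exact zero_mem _
    | add x y _ _ hx hy => exact add_mem hx hy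
    | smul r x _ hx =>
      have : r • x = π r • x := by
        rw [Algebra.smul_def, Algebra.smul_def, RingHom.algebraMap_toAlgebra', hφ]
      rw [this]
      exact Submodule.smul_mem _ _ hx
  obtain ⟨E, hE, hsep, hfin⟩ := exists_injective_cogenerator R'
  have := hfin Λ
  have hfin' : Module.Finite Λ (Coinduced R' Λ E) := Coinduced.finite
  refine enoughFGInjectives_of_separating fun M x hx ↦ ?_
  let : Module R' M := Module.compHom M (algebraMap R' Λ)
  have : IsScalarTower R' Λ M := .of_algebraMap_smul fun _ _ ↦ rfl
  obtain ⟨f, hf⟩ := hsep M x hx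
  refine ⟨.of Λ (Coinduced R' Λ E), Coinduced.lift f, Coinduced.injective hE, fun h ↦ hf ?_⟩
  have h1 : Coinduced.lift (Λ := Λ) f x 1 = 0 := by
    rw [h]; rfl
  rwa [Coinduced.lift_apply, one_smul] at h1

section

variable {Λ : Type u} [Ring Λ]

/-- The module `Z` is annihilated by the ideal `𝔄`. -/
def IsKilled (𝔄 : Ideal Λ) (Z : Type u) [AddCommGroup Z] [Module Λ Z] : Prop :=
  ∀ a ∈ 𝔄, ∀ z : Z, a • z = 0

variable {𝔄 : Ideal Λ} {P : Type u} [AddCommGroup P] [Module Λ P]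
  (hP : traceSubmodule Λ P Λ = 𝔄)

include hP

theorem apply_mem_of_trace (f : P →ₗ[Λ] Λ) (p : P) : f p ∈ 𝔄 := by
  rw [← hP]
  exact Submodule.mem_iSup_of_mem f ⟨p, rfl⟩

theorem map_smul_eq_zero_of_trace {X Y : Type u} [AddCommGroup X] [Module Λ X] [AddCommGroup Y]
    [Module Λ Y] (d : X →ₗ[Λ] Y) (hd : ∀ h : P →ₗ[Λ] X, d ∘ₗ h = 0) {a : Λ} (ha : a ∈ 𝔄) (x : X) :
    d (a • x) = 0 := by
  rw [← hP] at ha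
  have hle : traceSubmodule Λ P Λ ≤ LinearMap.ker (d ∘ₗ LinearMap.toSpanSingleton Λ X x) := by
    refine iSup_le ?_
    rintro f _ ⟨p, rfl⟩
    exact LinearMap.congr_fun (hd (LinearMap.toSpanSingleton Λ X x ∘ₗ f)) p
  exact hle ha

theorem IsKilled.of_hom_eq_zero {X : Type u} [AddCommGroup X] [Module Λ X]
    (h : ∀ f : P →ₗ[Λ] X, f = 0) : IsKilled 𝔄 X := fun _ ha x ↦
  map_smul_eq_zero_of_trace hP LinearMap.id (fun f ↦ by rw [h f, LinearMap.comp_zero]) ha x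

theorem IsKilled.hom_eq_zero [Module.Projective Λ P] {X : Type u} [AddCommGroup X] [Module Λ X]
    (hX : IsKilled 𝔄 X) (f : P →ₗ[Λ] X) : f = 0 := by
  obtain ⟨s, hs⟩ := Module.projective_def'.1 (inferInstance : Module.Projective Λ P)
  ext p
  have h1 : p = (s p).sum fun q a ↦ a • q := (LinearMap.congr_fun hs p).symm
  rw [h1, Finsupp.sum, map_sum, LinearMap.zero_apply]
  refine Finset.sum_eq_zero fun q _ ↦ ?_
  rw [map_smul]
  exact hX _ (apply_mem_of_trace hP (Finsupp.lapply q ∘ₗ s) p) _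

end

section HomModule

variable {Λ : Type u} [Ring Λ] {P : Type u} [AddCommGroup P] [Module Λ P]
  {X Y : Type u} [AddCommGroup X] [Module Λ X] [AddCommGroup Y] [Module Λ Y]

/-- `Hom_Λ(P, X)` is a left module over `End_Λ(P)ᵒᵖ` by precomposition. -/
instance homModule : Module (Module.End Λ P)ᵐᵒᵖ (P →ₗ[Λ] X) where
  smul g f := f ∘ₗ g.unop
  one_smul _ := rfl
  mul_smul _ _ _ := rfl
  smul_zero _ := rfl
  smul_add _ _ _ := rfl
  add_smul g h f := LinearMap.ext fun p ↦ map_add f (g.unop p) (h.unop p)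
  zero_smul f := LinearMap.ext fun _ ↦ map_zero f

variable (P) in
/-- Postcomposition with a linear map, as a map of modules over `End_Λ(P)ᵒᵖ`. -/
def homPost (φ : X →ₗ[Λ] Y) : (P →ₗ[Λ] X) →ₗ[(Module.End Λ P)ᵐᵒᵖ] (P →ₗ[Λ] Y) where
  toFun f := φ ∘ₗ f
  map_add' f g := LinearMap.comp_add f g φ
  map_smul' _ _ := rfl

@[simp]
theorem homPost_apply (φ : X →ₗ[Λ] Y) (f : P →ₗ[Λ] X) : homPost P φ f = φ ∘ₗ f := rfl

variable (Λ P) in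
/-- `Hom_Λ(P, Pᵐ)` is free over `End_Λ(P)ᵒᵖ`. -/
def homPiEquiv (m : ℕ) :
    (P →ₗ[Λ] (Fin m → P)) ≃ₗ[(Module.End Λ P)ᵐᵒᵖ] (Fin m → (Module.End Λ P)ᵐᵒᵖ) where
  toFun f i := MulOpposite.op (LinearMap.proj i ∘ₗ f)
  invFun g := LinearMap.pi fun i ↦ (g i).unop
  map_add' _ _ := rfl
  map_smul' _ _ := rfl
  left_inv _ := rfl
  right_inv _ := rfl

instance homPi_projective (m : ℕ) :
    Module.Projective (Module.End Λ P)ᵐᵒᵖ (P →ₗ[Λ] (Fin m → P)) :=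
  Module.Projective.of_equiv (homPiEquiv Λ P m).symm

instance homPi_finite (m : ℕ) : Module.Finite (Module.End Λ P)ᵐᵒᵖ (P →ₗ[Λ] (Fin m → P)) :=
  Module.Finite.equiv (homPiEquiv Λ P m).symm

variable {m : ℕ} {f : (Fin m → P) →ₗ[Λ] X}
  (hf : Function.Surjective (homPost P f))

include hf

theorem homPost_ses : IsSES (homPost P (LinearMap.ker f).subtype) (homPost P f) where
  inj g h hgh := LinearMap.ext fun p ↦ Subtype.ext (LinearMap.congr_fun hgh p)
  exact g := by
    constructor
    · intro hg
      exact ⟨g.codRestrict _ fun p ↦ LinearMap.congr_fun hg p, rfl⟩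
    · rintro ⟨h, rfl⟩
      exact LinearMap.ext fun p ↦ (h p).2
  surj := hf

theorem exists_retraction [Module.Projective (Module.End Λ P)ᵐᵒᵖ (P →ₗ[Λ] X)] :
    ∃ r : (Fin m → P) →ₗ[Λ] LinearMap.ker f,
      ∀ h : P →ₗ[Λ] LinearMap.ker f, r ∘ₗ (LinearMap.ker f).subtype ∘ₗ h = h := by
  classical
  obtain ⟨s, hs⟩ := Module.projective_lifting_property (homPost P f) LinearMap.id hf
  have hs' : ∀ g, f ∘ₗ s g = g := fun g ↦ LinearMap.congr_fun hs g
  let e : Fin m → (P →ₗ[Λ] (Fin m → P)) := LinearMap.single Λ fun _ ↦ P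
  have he : ∀ x : Fin m → P, ∑ i, e i (x i) = x := fun x ↦ Finset.univ_sum_single x
  let t : (Fin m → P) →ₗ[Λ] (Fin m → P) := ∑ i, s (f ∘ₗ e i) ∘ₗ LinearMap.proj i
  have ht : ∀ x, t x = ∑ i, s (f ∘ₗ e i) (x i) := fun x ↦ by simp [t]
  have hft : ∀ x, f (t x) = f x := by
    intro x
    rw [ht, map_sum]
    have : ∀ i, f (s (f ∘ₗ e i) (x i)) = f (e i (x i)) := fun i ↦ LinearMap.congr_fun (hs' _) _
    rw [Finset.sum_congr rfl fun i _ ↦ this i, ← map_sum, he]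
  have hth : ∀ h : P →ₗ[Λ] (Fin m → P), t ∘ₗ h = s (f ∘ₗ h) := by
    intro h
    have h1 : f ∘ₗ h = ∑ i, MulOpposite.op (LinearMap.proj i ∘ₗ h : Module.End Λ P) •
        (f ∘ₗ e i) := by
      ext p
      rw [LinearMap.sum_apply, LinearMap.comp_apply, ← he (h p), map_sum]
      rfl
    rw [h1, map_sum]
    ext1 p
    rw [LinearMap.comp_apply, ht, LinearMap.sum_apply]
    refine Finset.sum_congr rfl fun i _ ↦ ?_
    rw [map_smul]
    rfl
  have hk : ∀ x, (LinearMap.id - t : (Fin m → P) →ₗ[Λ] (Fin m → P)) x ∈ LinearMap.ker f := by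
    intro x
    simp [hft]
  refine ⟨(LinearMap.id - t).codRestrict _ hk, fun h ↦ ?_⟩
  · refine LinearMap.ext fun p ↦ ?_
    apply Subtype.ext
    have h1 := LinearMap.congr_fun (hth ((LinearMap.ker f).subtype ∘ₗ h)) p
    have h2 : f ∘ₗ (LinearMap.ker f).subtype ∘ₗ h = 0 := LinearMap.ext fun p ↦ (h p).2
    rw [h2, map_zero] at h1
    have h3 : t (h p) = 0 := h1
    change (h p : Fin m → P) - t (h p) = h p
    rw [h3, sub_zero]

end HomModule

section Dimension

variable {Λ : Type u} [Ring Λ] {P : Type u} [AddCommGroup P] [Module Λ P]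

/-- The kernel of a map is a retract of `Pᵐ × K ⧸ 𝔄 K`, if `Hom(P, X)` is projective. -/
theorem ExtVanish.ker_of_projective {𝔄 : Ideal Λ} [𝔄.IsTwoSided]
    (hP : traceSubmodule Λ P Λ = 𝔄) [Module.Projective Λ P] {X M : Type u}
    [AddCommGroup X] [Module Λ X] [AddCommGroup M] [Module Λ M]
    {m : ℕ} {f : (Fin m → P) →ₗ[Λ] X} (hf : Function.Surjective (homPost P f))
    [Module.Projective (Module.End Λ P)ᵐᵒᵖ (P →ₗ[Λ] X)] {i : ℕ}
    (hM : ExtVanish Λ (LinearMap.ker f ⧸ 𝔄 • (⊤ : Submodule Λ (LinearMap.ker f))) M (i + 1)) :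
    ExtVanish Λ (LinearMap.ker f) M (i + 1) := by
  obtain ⟨r, hr⟩ := exists_retraction hf
  let K := LinearMap.ker f
  let d : K →ₗ[Λ] K := LinearMap.id - r ∘ₗ K.subtype
  have hd : 𝔄 • (⊤ : Submodule Λ K) ≤ LinearMap.ker d := by
    refine Submodule.smul_le.2 fun a ha k _ ↦ ?_
    exact map_smul_eq_zero_of_trace hP d (fun h ↦ by
      rw [LinearMap.sub_comp, LinearMap.id_comp, LinearMap.comp_assoc, hr]
      exact sub_self h) ha k
  refine ExtVanish.of_retract_left
    (K.subtype.prod (𝔄 • (⊤ : Submodule Λ K)).mkQ) (r.coprod (Submodule.liftQ _ d hd)) ?_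
    ((ExtVanish.of_projective.pi_left m).prod_left hM)
  ext k
  simp [d]

/-- If `M` has no extensions with the quotients of modules in `D` that are annihilated by `𝔄`, then
`Ext^j(X, M)` vanishes above the projective dimension of the module `Hom(P, X)`, for `X` in `D`. -/
theorem extVanish_of_hasProjectiveDimensionLT [IsNoetherianRing Λ] {𝔄 : Ideal Λ} [𝔄.IsTwoSided]
    (hP : traceSubmodule Λ P Λ = 𝔄) [Module.Projective Λ P] [Module.Finite Λ P]
    (happrox : ∀ X : FGModuleCat.{u} Λ, ∃ (m : ℕ) (f : (Fin m → P) →ₗ[Λ] X),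
      Function.Surjective (homPost P f))
    (D : FGModuleCat.{u} Λ → Prop)
    (hD : ∀ X, D X → ∀ (m : ℕ) (f : (Fin m → P) →ₗ[Λ] X), Function.Surjective (homPost P f) →
      D (.of Λ (LinearMap.ker f)))
    {M : Type u} [AddCommGroup M] [Module Λ M]
    (hM : ∀ X, D X → ∀ (Z : FGModuleCat.{u} Λ) (g : X →ₗ[Λ] Z), Function.Surjective g →
      IsKilled 𝔄 Z → ∀ i, ExtVanish Λ Z M i) (n : ℕ) :
    ∀ X, D X → HasProjectiveDimensionLT (ModuleCat.of (Module.End Λ P)ᵐᵒᵖ (P →ₗ[Λ] X)) (n + 1) →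
      ∀ j, ExtVanish Λ X M (n + 2 + j) := by
  have step : ∀ X, D X → ∀ (m : ℕ) (f : (Fin m → P) →ₗ[Λ] X), Function.Surjective (homPost P f) →
      ∀ j, ExtVanish Λ (LinearMap.ker f) M (j + 1) → ExtVanish Λ X M (j + 2) := by
    intro X hX m f hf j hj
    let W := LinearMap.range f
    have h1 : IsSES (LinearMap.ker f).subtype f.rangeRestrict :=
      ⟨Subtype.val_injective, fun x ↦ by
        rw [← LinearMap.mem_ker, LinearMap.ker_rangeRestrict]; simp,
        f.surjective_rangeRestrict⟩
    have hW : ExtVanish Λ W M (j + 2) := h1.left_last hj (ExtVanish.of_projective.pi_left m)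
    have hC : IsKilled 𝔄 (X ⧸ W) := by
      refine .of_hom_eq_zero hP fun g ↦ ?_
      obtain ⟨g', rfl⟩ := Module.projective_lifting_property W.mkQ g W.mkQ_surjective
      obtain ⟨g'', rfl⟩ := hf g'
      ext p
      simp [W]
    exact (IsSES.of_submodule W).left_middle hW
      (hM X hX (.of Λ (X ⧸ W)) W.mkQ W.mkQ_surjective hC _)
  induction n with
  | zero =>
    intro X hX hpd j
    obtain ⟨m, f, hf⟩ := happrox X
    rw [show 0 + 2 + j = j + 2 by omega]
    refine step X hX m f hf j ?_
    have : Projective (ModuleCat.of (Module.End Λ P)ᵐᵒᵖ (P →ₗ[Λ] X)) :=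
      projective_iff_hasProjectiveDimensionLT_one.2 hpd
    have : Module.Projective (Module.End Λ P)ᵐᵒᵖ (P →ₗ[Λ] X) :=
      (IsProjective.iff_projective _).2 this
    refine ExtVanish.ker_of_projective hP hf (hM _ (hD X hX m f hf) (.of Λ _)
      (Submodule.mkQ _) (Submodule.mkQ_surjective _) ?_ _)
    intro a ha z
    obtain ⟨k, rfl⟩ := Submodule.mkQ_surjective _ z
    rw [← map_smul, Submodule.mkQ_apply, Submodule.Quotient.mk_eq_zero]
    exact Submodule.smul_mem_smul ha Submodule.mem_top
  | succ n ih =>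
    intro X hX hpd j
    obtain ⟨m, f, hf⟩ := happrox X
    rw [show n + 1 + 2 + j = (n + 1 + j) + 2 by omega]
    refine step X hX m f hf _ ?_
    have hp : Projective (ModuleCat.of (Module.End Λ P)ᵐᵒᵖ (P →ₗ[Λ] (Fin m → P))) :=
      (IsProjective.iff_projective _).1 inferInstance
    have hp' : HasProjectiveDimensionLT
        (ModuleCat.of (Module.End Λ P)ᵐᵒᵖ (P →ₗ[Λ] (Fin m → P))) (n + 1) :=
      hasProjectiveDimensionLT_of_ge _ 1 _ (by omega)
    have := (homPost_ses hf).shortExact.hasProjectiveDimensionLT_X₁ (n + 1) hp' hpd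
    rw [show n + 1 + j + 1 = n + 2 + j by omega]
    exact ih _ (hD X hX m f hf) this j

end Dimension

/-- Over an artin algebra, every homomorphism from `P` to `X` factors through one `Pᵐ → X`. -/
theorem exists_homPost_surjective {R : Type v} [CommRing R] [IsArtinianRing R] {Λ : Type u}
    [Ring Λ] [Algebra R Λ] [Module.Finite R Λ] (P : Type u) [AddCommGroup P] [Module Λ P]
    [Module.Finite Λ P] (X : Type u) [AddCommGroup X] [Module Λ X] [Module.Finite Λ X] :
    ∃ (m : ℕ) (f : (Fin m → P) →ₗ[Λ] X), Function.Surjective (homPost P f) := by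
  classical
  let : Module R X := Module.compHom X (algebraMap R Λ)
  have : IsScalarTower R Λ X := .of_algebraMap_smul fun _ _ ↦ rfl
  let : Module R P := Module.compHom P (algebraMap R Λ)
  have : IsScalarTower R Λ P := .of_algebraMap_smul fun _ _ ↦ rfl
  have : SMulCommClass R Λ X := IsScalarTower.to_smulCommClass
  have : SMulCommClass R Λ P := IsScalarTower.to_smulCommClass
  have : Module.Finite R X := Module.Finite.trans Λ X
  obtain ⟨s, hs⟩ := (Module.Finite.fg_top : (⊤ : Submodule Λ P).FG)
  let ev : (P →ₗ[Λ] X) →ₗ[R] (s → X) :=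
    { toFun f p := f p
      map_add' _ _ := rfl
      map_smul' _ _ := rfl }
  have hev : Function.Injective ev := by
    intro f g hfg
    refine LinearMap.ext_on hs fun p hp ↦ ?_
    exact congrFun hfg ⟨p, hp⟩
  have : IsNoetherian R (P →ₗ[Λ] X) := isNoetherian_of_injective ev hev
  obtain ⟨m, b, hb⟩ := Submodule.fg_iff_exists_fin_generating_family.1
    (IsNoetherian.noetherian (⊤ : Submodule R (P →ₗ[Λ] X)))
  refine ⟨m, ∑ i, b i ∘ₗ LinearMap.proj i, fun g ↦ ?_⟩
  have hg : g ∈ Submodule.span R (Set.range b) := hb ▸ Submodule.mem_top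
  obtain ⟨c, rfl⟩ := (Submodule.mem_span_range_iff_exists_fun R).1 hg
  refine ⟨LinearMap.pi fun i ↦ c i • LinearMap.id, ?_⟩
  ext p
  simp only [homPost_apply, LinearMap.comp_apply, LinearMap.sum_apply, LinearMap.proj_apply,
    LinearMap.pi_apply, LinearMap.smul_apply, LinearMap.id_apply]
  exact Finset.sum_congr rfl fun i _ ↦ LinearMap.map_smul_of_tower (b i) (c i) p

/-- A bound on the projective dimensions of finitely generated modules, if the global dimension
is finite. -/
theorem exists_hasProjectiveDimensionLT_of_globalDim {Γ : Type u} [Ring Γ] (h : globalDim Γ < ⊤) :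
    ∃ n : ℕ, ∀ (M : Type u) [AddCommGroup M] [Module Γ M] [Module.Finite Γ M],
      HasProjectiveDimensionLT (ModuleCat.of Γ M) (n + 1) := by
  obtain ⟨n, hn⟩ : ∃ n : ℕ, globalDim Γ ≤ n := by
    induction hg : globalDim Γ with
    | bot => exact ⟨0, bot_le⟩
    | coe d =>
      induction d with
      | top => exact absurd hg h.ne
      | coe d => exact ⟨d, le_rfl⟩
  refine ⟨n, fun M _ _ _ ↦ ?_⟩
  rw [← HasProjectiveDimensionLE, ← projectiveDimension_le_iff]
  exact (le_iSup (fun M : FGModuleCat.{u} Γ ↦ projectiveDimension M.obj) (.of Γ M)).trans hn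

section

variable {Λ : Type u} [Ring Λ] {𝔄 : Ideal Λ} {P : Type u} [AddCommGroup P] [Module Λ P]

theorem IsKilled.quotient [𝔄.IsTwoSided] : IsKilled 𝔄 (Λ ⧸ 𝔄) := by
  intro a ha z
  obtain ⟨b, rfl⟩ := Submodule.mkQ_surjective _ z
  rw [← map_smul, Submodule.mkQ_apply, Submodule.Quotient.mk_eq_zero]
  exact 𝔄.mul_mem_right b ha

theorem IsKilled.exists_hom {Z : Type u} [AddCommGroup Z] [Module Λ Z] (hZ : IsKilled 𝔄 Z) (z : Z) :
    ∃ g : (Λ ⧸ 𝔄) →ₗ[Λ] Z, g (Submodule.Quotient.mk 1) = z :=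
  ⟨Submodule.liftQ _ (LinearMap.toSpanSingleton Λ Z z) fun a ha ↦ hZ a ha z, one_smul Λ z⟩

theorem homModule_hasProjectiveDimensionLT
    (happrox : ∀ X : FGModuleCat.{u} Λ, ∃ (m : ℕ) (f : (Fin m → P) →ₗ[Λ] X),
      Function.Surjective (homPost P f))
    {n : ℕ} (hn : ∀ (M : Type u) [AddCommGroup M] [Module (Module.End Λ P)ᵐᵒᵖ M]
      [Module.Finite (Module.End Λ P)ᵐᵒᵖ M],
      HasProjectiveDimensionLT (ModuleCat.of (Module.End Λ P)ᵐᵒᵖ M) (n + 1))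
    (X : FGModuleCat.{u} Λ) :
    HasProjectiveDimensionLT (ModuleCat.of (Module.End Λ P)ᵐᵒᵖ (P →ₗ[Λ] X)) (n + 1) := by
  obtain ⟨m, f, hf⟩ := happrox X
  have := Module.Finite.of_surjective (homPost P f) hf
  exact hn _

end

section

variable {Λ : Type u} [Ring Λ] [IsNoetherianRing Λ] {𝔄 : Ideal Λ} [𝔄.IsTwoSided] {P : Type u}
  [AddCommGroup P] [Module Λ P] [Module.Projective Λ P] [Module.Finite Λ P]
  (hP : traceSubmodule Λ P Λ = 𝔄)
  (happrox : ∀ X : FGModuleCat.{u} Λ, ∃ (m : ℕ) (f : (Fin m → P) →ₗ[Λ] X),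
    Function.Surjective (homPost P f))
  {n : ℕ} (hn : ∀ (M : Type u) [AddCommGroup M] [Module (Module.End Λ P)ᵐᵒᵖ M]
    [Module.Finite (Module.End Λ P)ᵐᵒᵖ M],
    HasProjectiveDimensionLT (ModuleCat.of (Module.End Λ P)ᵐᵒᵖ M) (n + 1))

/-- A module `Y` with `Ext(Λ ⧸ 𝔄, Y) = 0` satisfies `Ext(Z, Y) = 0` for all finitely generated `Z`
that are annihilated by `𝔄`. -/
theorem extVanish_of_isKilled {Y : Type u} [AddCommGroup Y] [Module Λ Y]
    (hY : ∀ i, ExtVanish Λ (Λ ⧸ 𝔄) Y i) (i : ℕ) (Z : FGModuleCat.{u} Λ) (hZ : IsKilled 𝔄 Z) :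
    ExtVanish Λ Z Y i := by
  induction i generalizing Z with
  | zero =>
    rw [ExtVanish.zero_iff]
    intro f
    ext z
    obtain ⟨g, rfl⟩ := hZ.exists_hom z
    exact LinearMap.congr_fun (ExtVanish.zero_iff.1 (hY 0) (f ∘ₗ g)) _
  | succ i ih =>
    classical
    obtain ⟨m, b, hb⟩ := Submodule.fg_iff_exists_fin_generating_family.1
      (Module.Finite.fg_top : (⊤ : Submodule Λ Z).FG)
    choose g hg using hZ.exists_hom
    let f : (Fin m → Λ ⧸ 𝔄) →ₗ[Λ] Z := ∑ j, g (b j) ∘ₗ LinearMap.proj j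
    have hf : Function.Surjective f := by
      rw [← LinearMap.range_eq_top, eq_top_iff, ← hb, Submodule.span_le]
      rintro _ ⟨j, rfl⟩
      refine ⟨Pi.single j (Submodule.Quotient.mk 1), ?_⟩
      simp only [f, LinearMap.sum_apply, LinearMap.comp_apply, LinearMap.proj_apply]
      rw [Finset.sum_eq_single j, Pi.single_eq_same, hg]
      · intro l _ hl
        rw [Pi.single_eq_of_ne hl, map_zero]
      · simp
    have hk : IsKilled 𝔄 (LinearMap.ker f) := fun a ha z ↦
      Subtype.ext (funext fun j ↦ IsKilled.quotient a ha _)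
    refine (IsSES.of_ker f hf).left_last (ih (.of Λ _) hk) ((hY _).pi_left m)

include hP happrox hn

/-- A module `Y` with `Ext(Λ ⧸ 𝔄, Y) = 0` has finite injective dimension. -/
theorem extVanish_of_local {Y : Type u} [AddCommGroup Y] [Module Λ Y]
    (hY : ∀ i, ExtVanish Λ (Λ ⧸ 𝔄) Y i) (X : FGModuleCat.{u} Λ) (j : ℕ) :
    ExtVanish Λ X Y (n + 2 + j) :=
  extVanish_of_hasProjectiveDimensionLT hP happrox (fun _ ↦ True) (fun _ _ _ _ _ ↦ trivial)
    (fun _ _ Z _ _ hZ i ↦ extVanish_of_isKilled hY i Z hZ) n X trivial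
    (homModule_hasProjectiveDimensionLT happrox hn X) j

/-- The module `Λ ⧸ 𝔄` has finite projective dimension. -/
theorem extVanish_quotient (hidem : 𝔄 * 𝔄 = 𝔄)
    (hsi : ∀ (Z : FGModuleCat.{u} Λ), IsKilled 𝔄 Z → ∀ i, ExtVanish Λ (Λ ⧸ 𝔄) Z (i + 1))
    (M : Type u) [AddCommGroup M] [Module Λ M] (j : ℕ) :
    ExtVanish Λ (Λ ⧸ 𝔄) M (n + 3 + j) := by
  have h𝔄 : ∀ Z : FGModuleCat.{u} Λ, IsKilled 𝔄 Z → ∀ i, ExtVanish Λ 𝔄 Z i := by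
    intro Z hZ i
    rcases i with _ | i
    · rw [ExtVanish.zero_iff]
      intro f
      have hle : 𝔄 * 𝔄 ≤ (LinearMap.ker f).map (Submodule.subtype 𝔄) := by
        rw [Ideal.mul_le]
        intro a ha b hb
        refine ⟨a • ⟨b, hb⟩, ?_, rfl⟩
        rw [SetLike.mem_coe, LinearMap.mem_ker, map_smul]
        exact hZ a ha _
      ext ⟨x, hx⟩
      rw [← hidem] at hx
      obtain ⟨y, hy, rfl⟩ := hle hx
      exact hy
    · exact (IsSES.of_submodule (Λ := Λ) (B := Λ) 𝔄).left_fst .of_projective (hsi Z hZ _)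
  rw [show n + 3 + j = n + 2 + j + 1 by omega]
  refine (IsSES.of_submodule (Λ := Λ) (B := Λ) 𝔄).left_last ?_ .of_projective
  refine extVanish_of_hasProjectiveDimensionLT hP happrox
    (fun X ↦ ∀ Z : FGModuleCat.{u} Λ, IsKilled 𝔄 Z → ∀ i, ExtVanish Λ X Z i) ?_ ?_ n
    (.of Λ 𝔄) h𝔄 (homModule_hasProjectiveDimensionLT happrox hn _) j
  · intro X hX m f hf Z hZ i
    have hW : LinearMap.range f = ⊤ := by
      have hC : IsKilled 𝔄 (X ⧸ LinearMap.range f) := by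
        refine .of_hom_eq_zero hP fun g ↦ ?_
        obtain ⟨g', rfl⟩ :=
          Module.projective_lifting_property (LinearMap.range f).mkQ g (Submodule.mkQ_surjective _)
        obtain ⟨g'', rfl⟩ := hf g'
        ext p
        simp
      have := ExtVanish.zero_iff.1 (hX (.of Λ _) hC 0) (LinearMap.range f).mkQ
      rw [← Submodule.ker_mkQ (LinearMap.range f), this, LinearMap.ker_zero]
    refine (IsSES.of_ker f (LinearMap.range_eq_top.1 hW)).left_fst ?_ (hX Z hZ _)
    refine ExtVanish.pi_left ?_ m
    rcases i with _ | i
    · exact ExtVanish.zero_iff.2 fun g ↦ hZ.hom_eq_zero hP g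
    · exact .of_projective
  · intro X hX Z g hg hZ i
    have : g = 0 := ExtVanish.zero_iff.1 (hX Z hZ 0) g
    have hsub : Subsingleton Z := ⟨fun x y ↦ by
      obtain ⟨x, rfl⟩ := hg x
      obtain ⟨y, rfl⟩ := hg y
      rw [this]; rfl⟩
    rcases i with _ | i
    · exact ExtVanish.zero_iff.2 fun h ↦ LinearMap.ext fun z ↦ by
        rw [Subsingleton.elim z 0, map_zero, map_zero]
    · exact .of_projective

end

section

variable {Λ : Type u} [Ring Λ] (𝔄 : Ideal Λ) [𝔄.IsTwoSided]

/-- A `Λ ⧸ 𝔄`-module, viewed as a `Λ`-module. -/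
def Res (_ : Ideal Λ) (X : Type u) : Type u := X

section Res

variable (X : Type u) [AddCommGroup X] [Module (Λ ⧸ 𝔄) X]

instance : AddCommGroup (Res 𝔄 X) := inferInstanceAs (AddCommGroup X)

instance : Module (Λ ⧸ 𝔄) (Res 𝔄 X) := inferInstanceAs (Module (Λ ⧸ 𝔄) X)

instance : Module Λ (Res 𝔄 X) := Module.compHom X (Ideal.Quotient.mk 𝔄)

theorem Res.mk_smul (a : Λ) (x : Res 𝔄 X) : Ideal.Quotient.mk 𝔄 a • x = a • x := rfl

instance : IsScalarTower Λ (Λ ⧸ 𝔄) (Res 𝔄 X) where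
  smul_assoc a q x := by
    obtain ⟨b, rfl⟩ := Ideal.Quotient.mk_surjective q
    have : a • Ideal.Quotient.mk 𝔄 b = Ideal.Quotient.mk 𝔄 (a * b) := rfl
    rw [this, map_mul, mul_smul, Res.mk_smul]

/-- The identity map between `X` and `Res 𝔄 X`. -/
def Res.equiv : Res 𝔄 X ≃ₗ[Λ ⧸ 𝔄] X := LinearEquiv.refl (Λ ⧸ 𝔄) X

theorem Res.isKilled : IsKilled 𝔄 (Res 𝔄 X) := fun a ha x ↦ by
  rw [← Res.mk_smul, Ideal.Quotient.eq_zero_iff_mem.2 ha, zero_smul]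

instance [Module.Finite (Λ ⧸ 𝔄) X] : Module.Finite Λ (Res 𝔄 X) :=
  have : Module.Finite (Λ ⧸ 𝔄) (Res 𝔄 X) := inferInstanceAs (Module.Finite (Λ ⧸ 𝔄) X)
  .trans (Λ ⧸ 𝔄) _

end Res

section Linear

variable {A B : Type u} [AddCommGroup A] [Module Λ A] [Module (Λ ⧸ 𝔄) A]
  [IsScalarTower Λ (Λ ⧸ 𝔄) A] [AddCommGroup B] [Module Λ B] [Module (Λ ⧸ 𝔄) B]
  [IsScalarTower Λ (Λ ⧸ 𝔄) B]

theorem smul_eq_mk_smul (a : Λ) (x : A) : a • x = Ideal.Quotient.mk 𝔄 a • x := by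
  have : Ideal.Quotient.mk 𝔄 a = a • (1 : Λ ⧸ 𝔄) := by
    rw [← map_one (Ideal.Quotient.mk 𝔄)]
    exact congrArg _ (mul_one a).symm
  rw [this, smul_assoc, one_smul]

/-- A `Λ`-linear map between `Λ ⧸ 𝔄`-modules is `Λ ⧸ 𝔄`-linear. -/
def extendToQuotient (f : A →ₗ[Λ] B) : A →ₗ[Λ ⧸ 𝔄] B where
  toFun := f
  map_add' := f.map_add
  map_smul' q x := by
    obtain ⟨a, rfl⟩ := Ideal.Quotient.mk_surjective q
    rw [← smul_eq_mk_smul, map_smul, RingHom.id_apply, smul_eq_mk_smul 𝔄]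

end Linear

/-- `Ext^i_Λ(Λ ⧸ 𝔄, Z) = 0` for `i > 0` and all finitely generated `Z` annihilated by `𝔄`, if `𝔄` is
a strong idempotent ideal. -/
theorem IsStrongIdempotent.extVanish (h𝔄 : IsStrongIdempotent 𝔄) (Z : FGModuleCat.{u} Λ)
    (hZ : IsKilled 𝔄 Z) (i : ℕ) : ExtVanish Λ (Λ ⧸ 𝔄) Z (i + 1) := by
  have ht : Module.IsTorsionBySet Λ Z (𝔄 : Set Λ) := fun z a ↦ hZ a a.2 z
  let : Module (Λ ⧸ 𝔄) Z := ht.module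
  have : IsScalarTower Λ (Λ ⧸ 𝔄) Z := Module.IsTorsionBySet.isScalarTower ht
  have : Module.Finite (Λ ⧸ 𝔄) Z := Module.Finite.of_restrictScalars_finite Λ (Λ ⧸ 𝔄) Z
  have h := h𝔄.ext_bijective (.of _ (Λ ⧸ 𝔄)) (.of _ Z) (i + 1)
  have hp : Projective (ModuleCat.of (Λ ⧸ 𝔄) (Λ ⧸ 𝔄)) :=
    (IsProjective.iff_projective _).1 inferInstance
  have h0 : ExtVanish Λ (Res 𝔄 (Λ ⧸ 𝔄)) (Res 𝔄 Z) (i + 1) := by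
    intro e
    obtain ⟨e', he'⟩ := h.2 e
    have : e' = 0 := Abelian.Ext.eq_zero_of_projective (P := ModuleCat.of (Λ ⧸ 𝔄) (Λ ⧸ 𝔄)) e'
    rw [this, map_zero] at he'
    exact he'.symm
  let ι : Z →ₗ[Λ] Res 𝔄 Z := ((Res.equiv 𝔄 Z).symm.restrictScalars Λ).toLinearMap
  let π : Res 𝔄 Z →ₗ[Λ] Z := ((Res.equiv 𝔄 Z).restrictScalars Λ).toLinearMap
  let ι' : (Λ ⧸ 𝔄) →ₗ[Λ] Res 𝔄 (Λ ⧸ 𝔄) :=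
    { toFun := (Res.equiv 𝔄 (Λ ⧸ 𝔄)).symm
      map_add' := map_add _
      map_smul' a q := by
        obtain ⟨b, rfl⟩ := Ideal.Quotient.mk_surjective q
        rfl }
  let π' : Res 𝔄 (Λ ⧸ 𝔄) →ₗ[Λ] (Λ ⧸ 𝔄) :=
    { toFun := Res.equiv 𝔄 (Λ ⧸ 𝔄)
      map_add' := map_add _
      map_smul' a q := by
        obtain ⟨b, rfl⟩ := Ideal.Quotient.mk_surjective q
        rfl }
  exact (h0.of_retract_right ι π rfl).of_retract_left ι' π' rfl

/-- The largest submodule of `M` that is annihilated by `𝔄`. -/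
def tors (M : Type u) [AddCommGroup M] [Module Λ M] : Submodule Λ M where
  carrier := {x | ∀ a ∈ 𝔄, a • x = 0}
  add_mem' hx hy a ha := by rw [smul_add, hx a ha, hy a ha, add_zero]
  zero_mem' a _ := smul_zero a
  smul_mem' b x hx a ha := by rw [smul_smul, hx _ (𝔄.mul_mem_right b ha)]

section Tors

variable {M N C : Type u} [AddCommGroup M] [Module Λ M] [AddCommGroup N] [Module Λ N]
  [AddCommGroup C] [Module Λ C]

theorem tors_isTorsionBySet : Module.IsTorsionBySet Λ (tors 𝔄 M) (𝔄 : Set Λ) :=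
  fun x a ↦ Subtype.ext (x.2 a a.2)

theorem tors_isKilled : IsKilled 𝔄 (tors 𝔄 M) := fun a ha x ↦ Subtype.ext (x.2 a ha)

instance torsModule : Module (Λ ⧸ 𝔄) (tors 𝔄 M) := (tors_isTorsionBySet 𝔄).module

instance torsIsScalarTower : IsScalarTower Λ (Λ ⧸ 𝔄) (tors 𝔄 M) :=
  Module.IsTorsionBySet.isScalarTower (tors_isTorsionBySet 𝔄)

theorem apply_mem_tors (hM : IsKilled 𝔄 M) (f : M →ₗ[Λ] N) (x : M) : f x ∈ tors 𝔄 N :=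
  fun a ha ↦ by rw [← map_smul, hM a ha, map_zero]

/-- Restriction of a linear map to the torsion submodules. -/
def torsMap (f : M →ₗ[Λ] N) : tors 𝔄 M →ₗ[Λ ⧸ 𝔄] tors 𝔄 N :=
  extendToQuotient 𝔄 <| (f ∘ₗ (tors 𝔄 M).subtype).codRestrict _
    (apply_mem_tors 𝔄 (tors_isKilled 𝔄) _)

@[simp]
theorem torsMap_coe (f : M →ₗ[Λ] N) (x : tors 𝔄 M) : (torsMap 𝔄 f x : N) = f x := rfl

/-- Torsion submodules of isomorphic modules. -/
def torsEquiv (e : M ≃ₗ[Λ] N) : tors 𝔄 M ≃ₗ[Λ ⧸ 𝔄] tors 𝔄 N :=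
  .ofLinearMap (torsMap 𝔄 e.toLinearMap) (torsMap 𝔄 e.symm.toLinearMap)
    (LinearMap.ext fun _ ↦ Subtype.ext (e.apply_symm_apply _))
    (LinearMap.ext fun _ ↦ Subtype.ext (e.symm_apply_apply _))

variable (M N) in
/-- The torsion submodule of a product. -/
def torsProd : tors 𝔄 (M × N) ≃ₗ[Λ ⧸ 𝔄] tors 𝔄 M × tors 𝔄 N :=
  .ofLinearMap ((torsMap 𝔄 (LinearMap.fst Λ M N)).prod (torsMap 𝔄 (LinearMap.snd Λ M N)))
    ((torsMap 𝔄 (LinearMap.inl Λ M N)).coprod (torsMap 𝔄 (LinearMap.inr Λ M N)))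
    (LinearMap.ext fun x ↦ Prod.ext (Subtype.ext (by simp)) (Subtype.ext (by simp)))
    (LinearMap.ext fun x ↦ Subtype.ext (by simp))

variable (X : Type u) [AddCommGroup X] [Module (Λ ⧸ 𝔄) X]

/-- A module annihilated by `𝔄` is its own torsion submodule. -/
def torsRes : tors 𝔄 (Res 𝔄 X) ≃ₗ[Λ ⧸ 𝔄] Res 𝔄 X :=
  { extendToQuotient 𝔄 (tors 𝔄 (Res 𝔄 X)).subtype with
    invFun := fun x ↦ ⟨x, apply_mem_tors 𝔄 (Res.isKilled 𝔄 X) LinearMap.id x⟩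
    left_inv := fun _ ↦ rfl
    right_inv := fun _ ↦ rfl }

theorem tors_injective (hM : Module.Injective Λ M) : Module.Injective (Λ ⧸ 𝔄) (tors 𝔄 M) where
  out X Y _ _ _ _ f hf g := by
    let f' : Res 𝔄 X →ₗ[Λ] Res 𝔄 Y :=
      ((Res.equiv 𝔄 Y).symm.toLinearMap ∘ₗ f ∘ₗ (Res.equiv 𝔄 X).toLinearMap).restrictScalars Λ
    let g' : Res 𝔄 X →ₗ[Λ] tors 𝔄 M :=
      (g ∘ₗ (Res.equiv 𝔄 X).toLinearMap).restrictScalars Λ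
    obtain ⟨h, hh⟩ := hM.out f' hf ((tors 𝔄 M).subtype ∘ₗ g')
    refine ⟨extendToQuotient 𝔄 (h.codRestrict _ (apply_mem_tors 𝔄 (Res.isKilled 𝔄 Y) _)) ∘ₗ
      (Res.equiv 𝔄 Y).symm.toLinearMap, fun x ↦ Subtype.ext (hh x)⟩

variable {𝔄} in
/-- The torsion functor preserves short exact sequences `0 → M → N → C → 0` with
`Ext¹(Λ ⧸ 𝔄, M) = 0`. -/
theorem IsSES.tors {f : M →ₗ[Λ] N} {g : N →ₗ[Λ] C} (h : IsSES f g)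
    (hM : ExtVanish Λ (Λ ⧸ 𝔄) M 1) : IsSES (torsMap 𝔄 f) (torsMap 𝔄 g) where
  inj x y hxy := Subtype.ext (h.inj (congrArg Subtype.val hxy))
  exact y := by
    constructor
    · intro hy
      obtain ⟨x, hx⟩ := (h.exact y).1 (congrArg Subtype.val hy)
      refine ⟨⟨x, fun a ha ↦ h.inj ?_⟩, Subtype.ext hx⟩
      rw [map_smul, hx, map_zero, y.2 a ha]
    · rintro ⟨x, rfl⟩
      exact Subtype.ext (h.exact.apply_apply_eq_zero _)
  surj z := by
    obtain ⟨φ, hφ⟩ := (tors_isKilled 𝔄).exists_hom z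
    obtain ⟨ψ, hψ⟩ := h.exists_lift hM ((IgusaTodorov.tors 𝔄 C).subtype ∘ₗ φ)
    refine ⟨⟨ψ (Submodule.Quotient.mk 1), apply_mem_tors 𝔄 .quotient ψ _⟩, Subtype.ext ?_⟩
    change (g ∘ₗ ψ) _ = _
    rw [hψ, ← hφ]
    rfl

variable {𝔄} in
/-- The quotient of an acyclic module by its torsion submodule. -/
theorem extVanish_quotient_tors [IsNoetherianRing Λ] [Module.Finite Λ M]
    (hsi : ∀ (Z : FGModuleCat.{u} Λ), IsKilled 𝔄 Z → ∀ i, ExtVanish Λ (Λ ⧸ 𝔄) Z (i + 1))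
    (hM : ∀ i, ExtVanish Λ (Λ ⧸ 𝔄) M (i + 1)) (i : ℕ) :
    ExtVanish Λ (Λ ⧸ 𝔄) (M ⧸ tors 𝔄 M) i := by
  have hT := hsi (.of Λ (tors 𝔄 M)) (tors_isKilled 𝔄)
  have hs := IsSES.of_submodule (tors 𝔄 M)
  rcases i with _ | i
  · rw [ExtVanish.zero_iff]
    intro f
    obtain ⟨ψ, rfl⟩ := hs.exists_lift (hT 0) f
    ext1
    ext
    rw [LinearMap.comp_apply, LinearMap.comp_apply, Submodule.mkQ_apply (tors 𝔄 M),
      (Submodule.Quotient.mk_eq_zero _).2 (apply_mem_tors 𝔄 .quotient ψ _)]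
    rfl
  · exact hs.right_last (hT _) (hM _)

end Tors

section FG

/-- Restriction of scalars of finitely generated modules. -/
def resFG (X : FGModuleCat.{u} (Λ ⧸ 𝔄)) : FGModuleCat.{u} Λ := .of Λ (Res 𝔄 X)

variable [IsNoetherianRing Λ]

instance (M : Type u) [AddCommGroup M] [Module Λ M] [Module.Finite Λ M] :
    Module.Finite (Λ ⧸ 𝔄) (tors 𝔄 M) :=
  Module.Finite.of_restrictScalars_finite Λ (Λ ⧸ 𝔄) _

/-- The torsion submodule of a finitely generated module. -/
def torsFG (M : FGModuleCat.{u} Λ) : FGModuleCat.{u} (Λ ⧸ 𝔄) := .of (Λ ⧸ 𝔄) (tors 𝔄 M)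

variable {𝔄}

theorem StablyIso.torsFG {M N : FGModuleCat.{u} Λ} (h : StablyIso Λ M N) :
    StablyIso (Λ ⧸ 𝔄) (torsFG 𝔄 M) (torsFG 𝔄 N) := by
  obtain ⟨I, J, hI, hJ, ⟨e⟩⟩ := h
  exact StablyIso.of_prod_equiv (tors_injective 𝔄 hI) (tors_injective 𝔄 hJ)
    ((torsProd 𝔄 M I).symm.trans <| (torsEquiv 𝔄 e).trans (torsProd 𝔄 N J))

theorem stablyIso_torsFG_prod {A B C : FGModuleCat.{u} Λ} (h : StablyIso Λ C (A × B)) :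
    StablyIso (Λ ⧸ 𝔄) (torsFG 𝔄 C) (torsFG 𝔄 A × torsFG 𝔄 B) :=
  (StablyIso.torsFG (N := .of Λ (A × B)) h).trans (.of_equiv (torsProd 𝔄 A B))

omit [IsNoetherianRing Λ] in
theorem IsSES.res {A B C : FGModuleCat.{u} (Λ ⧸ 𝔄)} {f : A →ₗ[Λ ⧸ 𝔄] B} {g : B →ₗ[Λ ⧸ 𝔄] C}
    (h : IsSES f g) : StableSES Λ (resFG 𝔄 A) (resFG 𝔄 B) (resFG 𝔄 C) := by
  let f' : Res 𝔄 A →ₗ[Λ ⧸ 𝔄] Res 𝔄 B := f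
  let g' : Res 𝔄 B →ₗ[Λ ⧸ 𝔄] Res 𝔄 C := g
  exact IsSES.stableSES (A := resFG 𝔄 A) (B := resFG 𝔄 B) (C := resFG 𝔄 C)
    (f := f'.restrictScalars Λ) (g := g'.restrictScalars Λ) ⟨h.inj, h.exact, h.surj⟩

end FG

end

section

variable {Λ : Type u} [Ring Λ] (H : EnoughFGInjectives Λ)

theorem ExtVanish.cosIter {X : Type u} [AddCommGroup X] [Module Λ X] {M : FGModuleCat.{u} Λ}
    {i : ℕ} (k : ℕ) (h : ExtVanish Λ X M (i + 1 + k)) :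
    ExtVanish Λ X (cosIter H k M) (i + 1) := by
  induction k generalizing i with
  | zero => exact h
  | succ k ih =>
    rw [cosIter_succ]
    refine (cos_ses H _).right_last (ih ?_) (.of_injective (injHull_injective H _))
    rwa [show i + 1 + 1 + k = i + 1 + (k + 1) by omega]

theorem cosIter_injective_of_extVanish {M : FGModuleCat.{u} Λ} (k : ℕ)
    (h : ∀ X : FGModuleCat.{u} Λ, ExtVanish Λ X M (1 + k)) :
    Module.Injective Λ (cosIter H k M) := by
  refine injective_of_extVanish fun X _ _ _ ↦ ExtVanish.cosIter H (i := 0) k ?_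
  rw [zero_add]
  exact h (.of Λ X)

theorem K₀.hom_eq_iterate {f : K₀ Λ →+ K₀ Λ} {k : ℕ}
    (h : ∀ M : FGModuleCat.{u} Λ, f (K₀.mk M) = K₀.mk (IgusaTodorov.cosIter H k M)) (x : K₀ Λ) :
    f x = (cosyzygyMap Λ)^[k] x := by
  obtain ⟨A, B, rfl⟩ := K₀.exists_eq_sub x
  rw [map_sub, iterate_map_sub, h, h, cosyzygyMap_iterate_mk H, cosyzygyMap_iterate_mk H]

variable [IsNoetherianRing Λ] {𝔄 : Ideal Λ} [𝔄.IsTwoSided] (H' : EnoughFGInjectives (Λ ⧸ 𝔄))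

theorem stablyIso_torsFG_cos {N : FGModuleCat.{u} Λ}
    (hN : ∀ i, ExtVanish Λ (Λ ⧸ 𝔄) N (i + 1)) :
    StablyIso (Λ ⧸ 𝔄) (torsFG 𝔄 (cos H N)) (cos H' (torsFG 𝔄 N)) :=
  IsSES.stablyIso_cos (M := torsFG 𝔄 N) (I := torsFG 𝔄 (injHull H N)) (C := torsFG 𝔄 (cos H N)) H'
    ((cos_ses H N).tors (hN 0)) (tors_injective 𝔄 (injHull_injective H N))

variable (hsi : ∀ Z : FGModuleCat.{u} Λ, IsKilled 𝔄 Z → ∀ i, ExtVanish Λ (Λ ⧸ 𝔄) Z (i + 1))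

include hsi

theorem stablyIso_torsFG_cosIter_resFG (X : FGModuleCat.{u} (Λ ⧸ 𝔄)) (k : ℕ) :
    StablyIso (Λ ⧸ 𝔄) (torsFG 𝔄 (cosIter H k (resFG 𝔄 X))) (cosIter H' k X) := by
  induction k with
  | zero => exact (StablyIso.of_equiv (torsRes 𝔄 X)).trans (.of_equiv (Res.equiv 𝔄 X))
  | succ k ih =>
    rw [cosIter_succ, cosIter_succ]
    refine (stablyIso_torsFG_cos H H' fun i ↦ ExtVanish.cosIter H k ?_).trans (ih.cos H')
    rw [show i + 1 + k = i + k + 1 by omega]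
    exact hsi (resFG 𝔄 X) (Res.isKilled 𝔄 X) _

variable {n : ℕ}
  (hloc : ∀ Y : FGModuleCat.{u} Λ, (∀ i, ExtVanish Λ (Λ ⧸ 𝔄) Y i) →
    ∀ (X : FGModuleCat.{u} Λ) j, ExtVanish Λ X Y (n + 2 + j))

include hloc

theorem cosIter_resFG_injective {J : FGModuleCat.{u} (Λ ⧸ 𝔄)}
    (hJ : Module.Injective (Λ ⧸ 𝔄) J) {k : ℕ} (hk : n + 2 ≤ k) :
    Module.Injective Λ (cosIter H k (resFG 𝔄 J)) := by
  refine cosIter_injective_mono H hk (cosIter_injective_of_extVanish H _ fun X ↦ ?_)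
  let I := injHull H (resFG 𝔄 J)
  have hI := injHull_injective H (resFG 𝔄 J)
  let ι : Res 𝔄 J →ₗ[Λ] tors 𝔄 I := LinearMap.codRestrict _ (injHullι H (resFG 𝔄 J))
    (apply_mem_tors 𝔄 (Res.isKilled 𝔄 J) _)
  have hι : Function.Injective ι := fun x y hxy ↦
    injHullι_injective H _ (congrArg Subtype.val hxy)
  have hJ' : Module.Injective (Λ ⧸ 𝔄) (Res 𝔄 J) := hJ
  obtain ⟨r, hr⟩ := hJ'.out (extendToQuotient 𝔄 ι) hι LinearMap.id
  refine ExtVanish.of_retract_right ι (r.restrictScalars Λ) (LinearMap.ext hr) ?_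
  rw [show 1 + (n + 2) = n + 2 + 0 + 1 by omega]
  exact (IsSES.of_submodule (tors 𝔄 I)).right_fst (.of_injective hI)
    (hloc (.of Λ (I ⧸ tors 𝔄 I))
      (extVanish_quotient_tors hsi fun i ↦ .of_injective hI) X 0)

theorem stablyIso_cosIter_resFG_torsFG {N : FGModuleCat.{u} Λ}
    (hN : ∀ i, ExtVanish Λ (Λ ⧸ 𝔄) N (i + 1)) :
    StablyIso Λ (cosIter H (2 * (n + 3)) (resFG 𝔄 (torsFG 𝔄 N))) (cosIter H (2 * (n + 3)) N) := by
  let Y : FGModuleCat.{u} Λ := .of Λ (N ⧸ tors 𝔄 N)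
  let ρ : Res 𝔄 (tors 𝔄 N) →ₗ[Λ] tors 𝔄 N :=
    ((Res.equiv 𝔄 (tors 𝔄 N)).toLinearMap).restrictScalars Λ
  have hρ : IsSES ((tors 𝔄 N).subtype ∘ₗ ρ) (tors 𝔄 N).mkQ :=
    (IsSES.of_submodule (tors 𝔄 N)).comp_equiv
      ((Res.equiv 𝔄 (tors 𝔄 N)).restrictScalars Λ)
  have hs : StableSES Λ (resFG 𝔄 (torsFG 𝔄 N)) N Y :=
    IsSES.stableSES (A := resFG 𝔄 (torsFG 𝔄 N)) (C := Y) hρ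
  have hY : Module.Injective Λ (cosIter H (n + 2) Y) := by
    refine cosIter_injective_of_extVanish H _ fun X ↦ ?_
    rw [show 1 + (n + 2) = n + 2 + 1 by omega]
    exact hloc Y (extVanish_quotient_tors hsi hN) X 1
  have h := (hs.cosIter H (n + 2)).of_last_injective H
    (cosIter_injective_mono H (by omega) hY)
  rw [show 2 * (n + 3) = 2 * (n + 2) + 1 + 1 by omega]
  rw [cosIter_succ, cosIter_succ, cosIter_succ, cosIter_succ]
  exact h.cos H

theorem cos_cosIter_resFG (X : FGModuleCat.{u} (Λ ⧸ 𝔄)) :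
    StablyIso Λ (cosIter H (2 * (n + 3)) (resFG 𝔄 (cos H' X)))
      (cos H (cosIter H (2 * (n + 3)) (resFG 𝔄 X))) :=
  ((cos_ses H' X).res.cosIter H (n + 3)).of_middle_injective H
    (cosIter_resFG_injective H hsi hloc (injHull_injective H' X) (by omega))

/-- There is a homomorphism `[X] ↦ [Ω⁻ᵏ X]` from `K₀(Λ ⧸ 𝔄)` to `K₀(Λ)`. -/
theorem exists_resHom : ∃ G : K₀ (Λ ⧸ 𝔄) →+ K₀ Λ, ∀ X : FGModuleCat.{u} (Λ ⧸ 𝔄),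
    G (K₀.mk X) = K₀.mk (cosIter H (2 * (n + 3)) (resFG 𝔄 X)) := by
  refine ⟨K₀.lift (fun X ↦ K₀.mk (cosIter H (2 * (n + 3)) (resFG 𝔄 X))) (fun A B C e ↦ ?_)
    (fun J hJ ↦ ?_), fun X ↦ K₀.lift_mk _ _ _ X⟩
  · let e' : Res 𝔄 C ≃ₗ[Λ ⧸ 𝔄] Res 𝔄 A × Res 𝔄 B := e
    exact K₀.mk_eq_add_of_stablyIso
      (cosIter_prod (M := resFG 𝔄 A) (N := resFG 𝔄 B) H (resFG 𝔄 C)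
        (.of_equiv (e'.restrictScalars Λ)) _)
  · exact K₀.mk_injective (cosIter_resFG_injective H hsi hloc hJ (by omega))

omit hsi hloc in
/-- There is a homomorphism `[M] ↦ [Hom(Λ ⧸ 𝔄, Ω⁻ᵏ M)]` from `K₀(Λ)` to `K₀(Λ ⧸ 𝔄)`. -/
theorem exists_torsHom (k : ℕ) : ∃ F : K₀ Λ →+ K₀ (Λ ⧸ 𝔄), ∀ M : FGModuleCat.{u} Λ,
    F (K₀.mk M) = K₀.mk (torsFG 𝔄 (cosIter H k M)) := by
  refine ⟨K₀.lift (fun M ↦ K₀.mk (torsFG 𝔄 (cosIter H k M))) (fun A B C e ↦ ?_)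
    (fun I hI ↦ ?_), fun X ↦ K₀.lift_mk _ _ _ X⟩
  · exact K₀.mk_eq_add_of_stablyIso
      (stablyIso_torsFG_prod (cosIter_prod H C (.of_equiv e) _))
  · exact K₀.mk_injective (tors_injective 𝔄 (cosIter_injective H hI _))

include H H' in
/-- Finiteness of the `φ_r`-dimensions of `Λ` and `Λ ⧸ 𝔄` are equivalent, if `Λ ⧸ 𝔄` has finite
projective dimension and the modules `Y` with `Ext(Λ ⧸ 𝔄, Y) = 0` have bounded injective
dimension. -/
theorem phiRDim_quotient_lt_top_iff [IsArtinianRing Λ] [IsArtinianRing (Λ ⧸ 𝔄)]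
    (hpd : ∀ (M : FGModuleCat.{u} Λ) j, ExtVanish Λ (Λ ⧸ 𝔄) M (n + 3 + j)) :
    phiRDim (Λ ⧸ 𝔄) < ⊤ ↔ phiRDim Λ < ⊤ := by
  obtain ⟨G, hG⟩ := exists_resHom H hsi hloc
  obtain ⟨F, hF⟩ := exists_torsHom (𝔄 := 𝔄) H (2 * (n + 3))
  have hacyc : ∀ (M : FGModuleCat.{u} Λ) i,
      ExtVanish Λ (Λ ⧸ 𝔄) (cosIter H (2 * (n + 3)) M) (i + 1) := by
    intro M i
    refine ExtVanish.cosIter H _ ?_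
    rw [show i + 1 + 2 * (n + 3) = n + 3 + (i + n + 4) by omega]
    exact hpd M _
  have hGc : ∀ x, G (cosyzygyMap (Λ ⧸ 𝔄) x) = cosyzygyMap Λ (G x) := by
    refine K₀.hom_eq (f := G.comp (cosyzygyMap (Λ ⧸ 𝔄))) (g := (cosyzygyMap Λ).comp G) fun X ↦ ?_
    rw [AddMonoidHom.comp_apply, AddMonoidHom.comp_apply, cosyzygyMap_mk H', hG, hG,
      cosyzygyMap_mk H]
    exact K₀.mk_eq_of_stablyIso (cos_cosIter_resFG H H' hsi hloc X)
  have hFc : ∀ x, F (cosyzygyMap Λ x) = cosyzygyMap (Λ ⧸ 𝔄) (F x) := by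
    refine K₀.hom_eq (f := F.comp (cosyzygyMap Λ)) (g := (cosyzygyMap (Λ ⧸ 𝔄)).comp F) fun M ↦ ?_
    rw [AddMonoidHom.comp_apply, AddMonoidHom.comp_apply, cosyzygyMap_mk H, hF, hF,
      cosyzygyMap_mk H']
    have h1 : cosIter H (2 * (n + 3)) (cos H M) = cos H (cosIter H (2 * (n + 3)) M) :=
      (Function.iterate_succ_apply _ _ _).symm.trans (cosIter_succ H _ M)
    rw [h1]
    exact K₀.mk_eq_of_stablyIso (stablyIso_torsFG_cos H H' (hacyc M))
  have hGF : ∀ x, G (F x) = (cosyzygyMap Λ)^[2 * (n + 3) + 2 * (n + 3)] x := by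
    refine K₀.hom_eq_iterate H (f := G.comp F) fun M ↦ ?_
    rw [AddMonoidHom.comp_apply, hF, hG]
    refine K₀.mk_eq_of_stablyIso ?_
    rw [show cosIter H (2 * (n + 3) + 2 * (n + 3)) M =
      cosIter H (2 * (n + 3)) (cosIter H (2 * (n + 3)) M) from Function.iterate_add_apply _ _ _ _]
    exact stablyIso_cosIter_resFG_torsFG H hsi hloc (hacyc M)
  have hFG : ∀ x, F (G x) = (cosyzygyMap (Λ ⧸ 𝔄))^[2 * (n + 3) + 2 * (n + 3)] x := by
    refine K₀.hom_eq_iterate H' (f := F.comp G) fun X ↦ ?_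
    rw [AddMonoidHom.comp_apply, hG, hF]
    refine K₀.mk_eq_of_stablyIso ?_
    rw [← show cosIter H (2 * (n + 3) + 2 * (n + 3)) (resFG 𝔄 X) =
      cosIter H (2 * (n + 3)) (cosIter H (2 * (n + 3)) (resFG 𝔄 X)) from
        Function.iterate_add_apply _ _ _ _]
    exact stablyIso_torsFG_cosIter_resFG H H' hsi X _
  exact ⟨phiRDim_lt_top_of_intertwine F G _ hFc hGc hGF,
    phiRDim_lt_top_of_intertwine G F _ hGc hFc hFG⟩

end

end IgusaTodorov

end

/-- Here `Λ` is an artin algebra over `R`, `P` is a finitely generated projective left `Λ`-module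
with `τ_P Λ = 𝔄`, and `Γ = End_Λ(P)ᵒᵖ`. -/
theorem corollary4p11 {R : Type v} [CommRing R] [IsArtinianRing R]
    {Λ : Type u} [Ring Λ] [Algebra R Λ] [Module.Finite R Λ]
    (𝔄 : Ideal Λ) [𝔄.IsTwoSided] (h𝔄 : IgusaTodorov.IsStrongIdempotent 𝔄)
    (P : Type u) [AddCommGroup P] [Module Λ P] [Module.Finite Λ P] [Module.Projective Λ P]
    (hP : IgusaTodorov.traceSubmodule Λ P Λ = 𝔄)
    (hΓ : IgusaTodorov.globalDim (Module.End Λ P)ᵐᵒᵖ < ⊤) :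
    IgusaTodorov.phiRDim (Λ ⧸ 𝔄) < ⊤ ↔ IgusaTodorov.phiRDim Λ < ⊤ := by
  have := IgusaTodorov.isArtinianRing_of_artin_algebra R Λ
  have : Module.Finite R (Λ ⧸ 𝔄) :=
    Module.Finite.of_surjective (Ideal.Quotient.mkₐ R 𝔄).toLinearMap Ideal.Quotient.mk_surjective
  have := IgusaTodorov.isArtinianRing_of_artin_algebra R (Λ ⧸ 𝔄)
  obtain ⟨n, hn⟩ := IgusaTodorov.exists_hasProjectiveDimensionLT_of_globalDim hΓ
  have happrox := fun X : FGModuleCat.{u} Λ ↦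
    IgusaTodorov.exists_homPost_surjective (R := R) (Λ := Λ) P X
  have hsi := h𝔄.extVanish
  exact IgusaTodorov.phiRDim_quotient_lt_top_iff (IgusaTodorov.enoughFGInjectives R Λ)
    (IgusaTodorov.enoughFGInjectives R (Λ ⧸ 𝔄)) hsi
    (fun Y hY X j ↦ IgusaTodorov.extVanish_of_local hP happrox hn hY X j)
    (fun M j ↦ IgusaTodorov.extVanish_quotient hP happrox hn h𝔄.idempotent hsi M j)
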